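/- For a domain $D\subset\mathbb C^2$ let $H(D,D)$ be the set of holomorphic maps $D\to D$, and let $\widehat W_2(D)\subset D^2$ be the set of pairs $(x_1,x_2)$ of points of $D$ such that $\{x_1,x_2\}$ is determining with respect to $H(D,D)$, i.e. every $g\in H(D,D)$ with $g(x_1)=x_1$ and $g(x_2)=x_2$ is the identity map of $D$. In $\mathbb C^2$ with the Euclidean norm put $B_r=\{|z|<r\}$, $b_1=\{|z_1|^2+|z_2+1|^2<(1-10^{-4})^2\}$, $b_2=\{|z_1-0.02|^2+|z_2+1|^2<1\}$, and $$\Omega=(B_2\setminus\overline{B_1})\cup b_1\cup(b_2\cap B_2).$$ For $j=1,2,\dots$ put $$U_j=\{|z_1|<1.5,\ |z_2-2^{-j}|<2^{-2^j}\},\qquad \Delta_j=\{z\in B_2: z_2=2^{-j}\},$$ $$p_j=(-1.5,2^{-j}),\qquad q_j=(1.5,2^{-j}),$$ and let $p_0=(-1.5,0)$, $q_0=(1.5,0)$. Finally let $D=\Omega\cup\bigcup_{j\ge1}U_j$. Then: 1. $D$ is a bounded domain (open and connected) and $D\subset B_2$. 2. For every $j\ge1$, $p_j,q_j\in\Delta_j\subset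 D$, and there is a holomorphic retraction of $B_2$ onto $\Delta_j$ whose restriction to $D$ is a holomorphic retraction of $D$ onto $\Delta_j$; moreover $(p_j,q_j)\in D^2\setminus\widehat W_2(D)$. 3. $p_j\to p_0$ and $q_j\to q_0$ as $j\to\infty$, and $(p_0,q_0)\in\widehat W_2(D)$. 4. Consequently $\widehat W_2(D)$ is not open in $D^2$. -/

import Mathlib

open Set Filter Topology

namespace DeterminingSets

/-- `ℂⁿ` with the Euclidean norm. -/
abbrev Cn (n : ℕ) : Type := EuclideanSpace ℂ (Fin n)

/-- A bounded domain in `ℂⁿ`: a bounded, open, connected (hence nonempty) set. -/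
def IsBoundedDomain {n : ℕ} (D : Set (Cn n)) : Prop :=
  IsOpen D ∧ IsConnected D ∧ Bornology.IsBounded D

/-- `g` (considered on the open set `D` only) is a holomorphic self-map of `D`,
that is, an element of `H(D, D)`. -/
def IsHolEndo {n : ℕ} (D : Set (Cn n)) (g : Cn n → Cn n) : Prop :=
  DifferentiableOn ℂ g D ∧ MapsTo g D D

/-- `K ⊆ D` is a determining subset of `D` with respect to `H(D, D)`: every holomorphic self-map
of `D` fixing `K` pointwise is the identity map of `D`. -/
def IsDetermining {n : ℕ} (D K : Set (Cn n)) : Prop :=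
  K ⊆ D ∧ ∀ g : Cn n → Cn n, IsHolEndo D g → (∀ k ∈ K, g k = k) → ∀ z ∈ D, g z = z

/-- The set `Dˢ` of `s`-tuples of points of `D`. -/
def tuples {n : ℕ} (s : ℕ) (D : Set (Cn n)) : Set (Fin s → Cn n) :=
  {x | ∀ i, x i ∈ D}

/-- `Ŵ_s(D) ⊆ Dˢ`: the `s`-tuples of points of `D` that form a determining set with respect to
`H(D, D)`. -/
def WHat {n : ℕ} (s : ℕ) (D : Set (Cn n)) : Set (Fin s → Cn n) :=
  {x | x ∈ tuples s D ∧ IsDetermining D (range x)}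

/-- `r` is a holomorphic retraction of the open set `U` onto its subset `A`. -/
def IsHolRetraction {n : ℕ} (U A : Set (Cn n)) (r : Cn n → Cn n) : Prop :=
  IsHolEndo U r ∧ A ⊆ U ∧ r '' U = A ∧ ∀ z ∈ A, r z = z

/-- `Ω = (B₂ \ closure B₁) ∪ b₁ ∪ (b₂ ∩ B₂)`, where `B₂`, `B₁` are the balls about `0` of radius
`2` and `1`, and `b₁`, `b₂` are the balls about `(0, -1)` and `(0.02, -1)` of radius `1 - 10⁻⁴`
and `1`. -/
def Omega : Set (Cn 2) :=
  (Metric.ball 0 2 \ closure (Metric.ball 0 1)) ∪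
    Metric.ball (!₂[0, -1]) (1 - 1 / 10 ^ 4) ∪
    (Metric.ball (!₂[1 / 50, -1]) 1 ∩ Metric.ball 0 2)

/-- The bidisc `U_j`, with centre `(0, 2^(-j))` and radii `1.5` and `2^(-(2^j))`. -/
def bidisc (j : ℕ) : Set (Cn 2) :=
  {z | ‖z 0‖ < 3 / 2 ∧ ‖z 1 - 1 / 2 ^ j‖ < 1 / 2 ^ (2 ^ j)}

/-- `D = Ω ∪ ⋃_{j ≥ 1} U_j`. -/
def exampleDomain : Set (Cn 2) :=
  Omega ∪ ⋃ (j : ℕ) (_ : 1 ≤ j), bidisc j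

/-- The complex disc `Δ_j = {z ∈ B₂ | z₂ = 2^(-j)}`. -/
def disc (j : ℕ) : Set (Cn 2) :=
  {z | z ∈ Metric.ball (0 : Cn 2) 2 ∧ z 1 = 1 / 2 ^ j}

/-- `p_j = (-1.5, 2^(-j))` for `j ≥ 1`. -/
noncomputable def p (j : ℕ) : Cn 2 := !₂[-(3 / 2), 1 / 2 ^ j]

/-- `q_j = (1.5, 2^(-j))` for `j ≥ 1`. -/
noncomputable def q (j : ℕ) : Cn 2 := !₂[3 / 2, 1 / 2 ^ j]

/-- The limit point `p_0 = (-1.5, 0)` (which is not the value of `p` at `0`). -/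
noncomputable def pLim : Cn 2 := !₂[-(3 / 2), 0]

/-- The limit point `q_0 = (1.5, 0)` (which is not the value of `q` at `0`). -/
noncomputable def qLim : Cn 2 := !₂[3 / 2, 0]

end DeterminingSets

/-!
Write `D` for `exampleDomain`, `p₀, q₀` for `pLim, qLim` and `Δ_j` for `disc j`. The pair
`(p_j, q_j)` is not determining because `D` contains the whole slice `Δ_j` of the ball, so that the
holomorphic retraction `sliceRetraction` of the ball onto `Δ_j` restricts to `D`.

The main point is that `{p₀, q₀}` is determining. Let `g : D → D` be holomorphic with `g p₀ = p₀`
and `g q₀ = q₀`.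

* `D` contains the spherical shell `1 < |z| < 2`, so by a special case of Hartogs' theorem
  (`exists_extension_of_shell`, a Cauchy integral in the first variable) there is a holomorphic map
  `Φ` of the ball into its closure which agrees with `g` where `|z₁| > 1` or `|z₂| > 1`. It also
  agrees with `g` over the small discs `|z₂ - 2^(-j)| < 2^(-2^j)`, since `D` contains the whole
  slices over these (`extension_eq_on_smallDisc`).
* `Φ` fixes `p₀ = (-3/2, 0)` and `q₀ = (3/2, 0)`, hence the disc `z₂ = 0` pointwise
  (`fixes_disc_of_two_fixed_points`).
* Near the origin `D` consists of the bidiscs `U_j` only (`exists_mem_bidisc_of_norm_lt`). Hence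
  `h(w) = Φ₂(0, w)` maps each small disc far out into the union of all of them, and by the Schwarz
  lemma `|h'(0)| ≤ 1`. As the discs shrink doubly exponentially, `h` must map almost every one of
  them into itself, and `h'(0) = 1` (`deriv_eq_one_of_mapsTo_smallDisc`).
* By the Schwarz lemma on the line `z₁ = 0` the derivative of `Φ` at `0` is then the identity, and
  the equality case of that lemma on all lines through `0` gives `Φ = id`
  (`eq_id_of_fderiv_zero_eq_id`). So `g = id` on an open set, and on `D` by the identity principle.
-/

namespace DeterminingSets

/-! ### Holomorphic functions of several variables -/

open Metric Complex in
/-- A continuous family of holomorphic functions on a finite-dimensional space may be integrated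
over a compact parameter interval: Cauchy's estimate bounds the derivatives and makes them depend
continuously on the parameter, so one can differentiate under the integral sign. -/
theorem differentiableOn_intervalIntegral_of_continuousOn {E F : Type*}
    [NormedAddCommGroup E] [NormedSpace ℂ E] [ProperSpace E]
    [NormedAddCommGroup F] [NormedSpace ℂ F]
    {U : Set E} (hU : IsOpen U) {f : E → ℝ → F} (a b : ℝ)
    (hc : ContinuousOn (fun x : E × ℝ => f x.1 x.2) (U ×ˢ univ))
    (hd : ∀ t, DifferentiableOn ℂ (fun z => f z t) U) :
    DifferentiableOn ℂ (fun z => ∫ t in a..b, f z t) U := by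
  intro z₀ hz₀
  obtain ⟨ε, hε, hεU⟩ := Metric.isOpen_iff.1 hU z₀ hz₀
  set r := ε / 3 with hr
  have hr0 : 0 < r := by positivity
  have hK : closedBall z₀ (2 * r) ⊆ U :=
    (closedBall_subset_ball (by rw [hr]; linarith)).trans hεU
  have hcomp : IsCompact (closedBall z₀ (2 * r) ×ˢ uIcc a b) :=
    (isCompact_closedBall _ _).prod isCompact_uIcc
  have hcK : ContinuousOn (fun x : E × ℝ => f x.1 x.2) (closedBall z₀ (2 * r) ×ˢ uIcc a b) :=
    hc.mono (prod_mono hK (subset_univ _))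
  obtain ⟨M, hM⟩ := hcomp.exists_bound_of_continuousOn hcK
  have hcz : ∀ z ∈ U, Continuous (f z) := fun z hz =>
    continuousOn_univ.1 (hc.comp (f := fun t : ℝ => (z, t)) (by fun_prop)
      (fun t _ => ⟨hz, mem_univ _⟩))
  have hUn : U ∈ 𝓝 z₀ := hU.mem_nhds hz₀
  have hfd : ∀ t, ∀ z ∈ U, HasFDerivAt (fun z => f z t) (fderiv ℂ (fun z => f z t) z) z :=
    fun t z hz => ((hd t).differentiableAt (hU.mem_nhds hz)).hasFDerivAt
  have hcont : ContinuousOn (fun t => fderiv ℂ (fun z => f z t) z₀) (uIcc a b) := by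
    have huc := hcomp.uniformContinuousOn_of_continuous hcK
    rw [Metric.continuousOn_iff]
    intro t ht η hη
    obtain ⟨δ, hδ, H⟩ := Metric.uniformContinuousOn_iff.1 huc (η * r / 4) (by positivity)
    refine ⟨δ, hδ, fun s hs hst => ?_⟩
    have hsm : ∀ z ∈ closedBall z₀ (2 * r), ‖f z s - f z t‖ ≤ η * r / 4 := fun z hz => by
      rw [← dist_eq_norm]
      exact (H (z, s) ⟨hz, hs⟩ (z, t) ⟨hz, ht⟩ (by simpa [Prod.dist_eq] using hst)).le
    have hbU : ball z₀ r ⊆ closedBall z₀ (2 * r) :=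
      ball_subset_closedBall.trans (closedBall_subset_closedBall (by linarith))
    have hz₀K : z₀ ∈ closedBall z₀ (2 * r) := mem_closedBall_self (by positivity)
    have := norm_fderiv_le_div_of_mapsTo_ball (f := fun z => f z s - f z t) (c := z₀)
      (R₁ := r) (R₂ := η * r / 2)
      (((hd s).sub (hd t)).mono (hbU.trans hK)) (fun z hz => by
        rw [mem_closedBall, dist_eq_norm]
        calc _ ≤ ‖f z s - f z t‖ + ‖f z₀ s - f z₀ t‖ := norm_sub_le _ _
          _ ≤ η * r / 4 + η * r / 4 := add_le_add (hsm z (hbU hz)) (hsm z₀ hz₀K)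
          _ = _ := by ring) hr0
    rw [dist_eq_norm]
    have e : fderiv ℂ (fun z => f z s - f z t) z₀
        = fderiv ℂ (fun z => f z s) z₀ - fderiv ℂ (fun z => f z t) z₀ :=
      ((hfd s z₀ hz₀).sub (hfd t z₀ hz₀)).fderiv
    rw [← e]
    refine this.trans_lt ?_
    rw [div_lt_iff₀ hr0]
    nlinarith
  refine (intervalIntegral.hasFDerivAt_integral_of_dominated_of_fderiv_le
    (F := f) (F' := fun z t => fderiv ℂ (fun z => f z t) z) (bound := fun _ => 2 * M / r)
    (ball_mem_nhds z₀ hr0) ?_ ?_ ?_ ?_ ?_ ?_).differentiableAt.differentiableWithinAt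
  · filter_upwards [hUn] with z hz
    exact (hcz z hz).aestronglyMeasurable
  · exact (hcz z₀ hz₀).intervalIntegrable _ _
  · exact (hcont.mono uIoc_subset_uIcc).aestronglyMeasurable measurableSet_uIoc
  · refine Eventually.of_forall fun t ht z hz => ?_
    have hsub : ball z r ⊆ closedBall z₀ (2 * r) := fun y hy => by
      rw [mem_ball] at hy hz
      rw [mem_closedBall]
      linarith [dist_triangle y z z₀]
    refine norm_fderiv_le_div_of_mapsTo_ball ((hd t).mono (hsub.trans hK)) (fun y hy => ?_) hr0
    rw [mem_closedBall, dist_eq_norm]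
    have h1 := hM (y, t) ⟨hsub hy, uIoc_subset_uIcc ht⟩
    have h2 := hM (z, t) ⟨hsub (mem_ball_self hr0), uIoc_subset_uIcc ht⟩
    calc _ ≤ ‖f y t‖ + ‖f z t‖ := norm_sub_le _ _
      _ ≤ M + M := add_le_add h1 h2
      _ = _ := by ring
  · exact intervalIntegrable_const
  · refine Eventually.of_forall fun t _ z hz => hfd t z (hK ?_)
    exact closedBall_subset_closedBall (by linarith) (ball_subset_closedBall hz)

/-- The identity principle for holomorphic functions of several variables: a holomorphic function
on a connected open set that vanishes near one point is zero. It reduces to one variable, since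
any two points of a ball lie on a complex line. -/
theorem eqOn_of_differentiableOn_of_eventuallyEq {E F : Type*}
    [NormedAddCommGroup E] [NormedSpace ℂ E] [NormedAddCommGroup F] [NormedSpace ℂ F]
    [CompleteSpace F] {U : Set E} (hU : IsOpen U) (hUc : IsPreconnected U) {f g : E → F}
    (hf : DifferentiableOn ℂ f U) (hg : DifferentiableOn ℂ g U) {z₀ : E} (hz₀ : z₀ ∈ U)
    (h : f =ᶠ[𝓝 z₀] g) : EqOn f g U := by
  have key : U ⊆ {z | f =ᶠ[𝓝 z] g} := by
    refine hUc.subset_of_closure_inter_subset isOpen_setOfPred_eventually_nhds ⟨z₀, hz₀, h⟩ ?_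
    rintro z ⟨hz, hzU⟩
    obtain ⟨ε, hε, hεU⟩ := Metric.isOpen_iff.1 hU z hzU
    obtain ⟨w, hw, hwz⟩ := Metric.mem_closure_iff.1 hz ε hε
    have hwb : w ∈ Metric.ball z ε := by rwa [Metric.mem_ball, dist_comm]
    refine Filter.eventually_of_mem (Metric.ball_mem_nhds z hε) fun y hy => ?_
    -- Restrict `f` and `g` to the complex line through `w` and `y`.
    let l : ℂ → E := fun t => w + t • (y - w)
    have hl : Differentiable ℂ l := by fun_prop
    let V : Set ℂ := l ⁻¹' Metric.ball z ε
    have hVo : IsOpen V := Metric.isOpen_ball.preimage hl.continuous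
    have hVc : IsPreconnected V := by
      refine Convex.isPreconnected ?_
      intro s hs t ht a b ha hb hab
      have := (convex_ball z ε) hs ht ha hb hab
      have e : l (a • s + b • t) = a • l s + b • l t := by
        obtain rfl : b = 1 - a := by linarith
        simp only [l, ← Complex.coe_smul, smul_eq_mul]
        push_cast
        module
      rwa [mem_preimage, e]
    have e0 : l 0 = w := by simp [l]
    have e1 : l 1 = y := by simp [l]
    have hlV : MapsTo l V U := fun t ht => hεU ht
    have h0 : (0 : ℂ) ∈ V := by rwa [mem_preimage, e0]
    have h1 : (1 : ℂ) ∈ V := by rwa [mem_preimage, e1]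
    have hev : (f ∘ l) =ᶠ[𝓝 0] (g ∘ l) := by
      have : Tendsto l (𝓝 0) (𝓝 w) := by
        have := hl.continuous.tendsto 0
        rwa [e0] at this
      exact this.eventually hw
    have hfl := (hf.comp hl.differentiableOn hlV).analyticOnNhd hVo
    have hgl := (hg.comp hl.differentiableOn hlV).analyticOnNhd hVo
    have := hfl.eqOn_of_preconnected_of_eventuallyEq hgl hVc h0 hev h1
    simpa [e1] using this
  exact fun z hz => (key hz).self_of_nhds

/-! ### One complex variable -/

/-- The automorphism `z ↦ R² (z - a) / (R² - a z)` of the disc of radius `R` about `0`,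
for a real `a` with `|a| < R`; it sends `a` to `0` and its inverse is `discShift R (-a)`. -/
noncomputable def discShift (R a : ℝ) (z : ℂ) : ℂ := R ^ 2 * (z - a) / (R ^ 2 - a * z)

theorem discShift_denom_ne_zero {R a : ℝ} (ha : |a| < R) {z : ℂ} (hz : ‖z‖ ≤ R) :
    (R : ℂ) ^ 2 - a * z ≠ 0 := by
  intro h
  have hR : 0 < R := (abs_nonneg a).trans_lt ha
  have h1 : (R : ℂ) ^ 2 = a * z := sub_eq_zero.1 h
  have h2 : R ^ 2 = |a| * ‖z‖ := by
    have := congrArg norm h1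
    simpa [abs_of_pos hR] using this
  nlinarith [abs_nonneg a, norm_nonneg z]

/-- The identity behind `discShift` being a self-map of the disc: it shows that
`R² - |discShift R a z|²` and `R² - |z|²` have the same sign. -/
theorem norm_discShift_sq {R a : ℝ} (ha : |a| < R) {z : ℂ} (hz : ‖z‖ ≤ R) :
    (R ^ 2 - ‖discShift R a z‖ ^ 2) * ‖(R : ℂ) ^ 2 - a * z‖ ^ 2
      = R ^ 2 * (R ^ 2 - a ^ 2) * (R ^ 2 - ‖z‖ ^ 2) := by
  have h0 := norm_pos_iff.2 (discShift_denom_ne_zero ha hz)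
  have hR : 0 < R := (abs_nonneg a).trans_lt ha
  have e : ‖discShift R a z‖ ^ 2 * ‖(R : ℂ) ^ 2 - a * z‖ ^ 2 = R ^ 4 * ‖z - a‖ ^ 2 := by
    rw [discShift, norm_div, norm_mul, norm_pow, Complex.norm_real, Real.norm_eq_abs,
      abs_of_pos hR, div_pow, div_mul_cancel₀ _ (pow_ne_zero 2 h0.ne')]
    ring
  rw [sub_mul, e]
  simp only [Complex.sq_norm, Complex.normSq_apply]
  simp [pow_two]
  ring

theorem norm_discShift_le {R a : ℝ} (ha : |a| < R) {z : ℂ} (hz : ‖z‖ ≤ R) :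
    ‖discShift R a z‖ ≤ R := by
  have h := norm_discShift_sq ha hz
  have h0 := norm_pos_iff.2 (discShift_denom_ne_zero ha hz)
  have hR : 0 < R := (abs_nonneg a).trans_lt ha
  have ha2 : a ^ 2 < R ^ 2 := sq_lt_sq' (by linarith [neg_abs_le a]) ((le_abs_self a).trans_lt ha)
  have hz2 : ‖z‖ ^ 2 ≤ R ^ 2 := by gcongr
  by_contra! hc
  have hc2 : R ^ 2 < ‖discShift R a z‖ ^ 2 := by gcongr
  have h1 : (R ^ 2 - ‖discShift R a z‖ ^ 2) * ‖(R : ℂ) ^ 2 - a * z‖ ^ 2 < 0 :=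
    mul_neg_of_neg_of_pos (by linarith) (by positivity)
  have h2 : 0 ≤ R ^ 2 * (R ^ 2 - a ^ 2) * (R ^ 2 - ‖z‖ ^ 2) :=
    mul_nonneg (mul_nonneg (by positivity) (by linarith)) (by linarith)
  linarith

theorem norm_discShift_lt {R a : ℝ} (ha : |a| < R) {z : ℂ} (hz : ‖z‖ < R) :
    ‖discShift R a z‖ < R := by
  have h := norm_discShift_sq ha hz.le
  have h0 := norm_pos_iff.2 (discShift_denom_ne_zero ha hz.le)
  have hR : 0 < R := (abs_nonneg a).trans_lt ha
  have ha2 : a ^ 2 < R ^ 2 := sq_lt_sq' (by linarith [neg_abs_le a]) ((le_abs_self a).trans_lt ha)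
  have hz2 : ‖z‖ ^ 2 < R ^ 2 := by gcongr
  refine (norm_discShift_le ha hz.le).lt_of_ne fun hc => ?_
  rw [hc, sub_self, zero_mul] at h
  have h2 : 0 < R ^ 2 * (R ^ 2 - a ^ 2) * (R ^ 2 - ‖z‖ ^ 2) :=
    mul_pos (mul_pos (by positivity) (by linarith)) (by linarith)
  linarith

theorem discShift_neg_discShift {R a : ℝ} (ha : |a| < R) {z : ℂ} (hz : ‖z‖ ≤ R) :
    discShift R (-a) (discShift R a z) = z := by
  have h0 := discShift_denom_ne_zero ha hz
  have h1 := discShift_denom_ne_zero (a := -a) (by rwa [abs_neg]) (norm_discShift_le ha hz)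
  have hx : discShift R a z * (R ^ 2 - a * z) = R ^ 2 * (z - a) := div_mul_cancel₀ _ h0
  rw [discShift, div_eq_iff h1]
  push_cast
  linear_combination hx

theorem differentiableAt_discShift {R a : ℝ} (ha : |a| < R) {z : ℂ} (hz : ‖z‖ ≤ R) :
    DifferentiableAt ℂ (discShift R a) z := by
  have := discShift_denom_ne_zero ha hz
  unfold discShift
  fun_prop (disch := assumption)

/-- A holomorphic self-map of a disc with two fixed points `±a` is the identity: after moving `a`
to the centre this is the equality case of the Schwarz lemma. -/
theorem eq_id_of_two_fixed_points {R a : ℝ} (ha0 : a ≠ 0) (ha : |a| < R) {f : ℂ → ℂ}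
    (hd : DifferentiableOn ℂ f (Metric.ball 0 R))
    (hm : MapsTo f (Metric.ball 0 R) (Metric.closedBall 0 R))
    (h1 : f a = a) (h2 : f (-a) = -a) {z : ℂ} (hz : z ∈ Metric.ball 0 R) : f z = z := by
  have hR : 0 < R := (abs_nonneg a).trans_lt ha
  have ha' : |-a| < R := by rwa [abs_neg]
  have hna : ‖(-a : ℂ)‖ < R := by simpa using ha
  set F : ℂ → ℂ := fun w => discShift R a (f (discShift R (-a) w)) with hF
  have hmem : ∀ w ∈ Metric.ball (0 : ℂ) R, discShift R (-a) w ∈ Metric.ball (0 : ℂ) R :=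
    fun w hw => by
      rw [mem_ball_zero_iff] at hw ⊢
      exact norm_discShift_lt ha' hw
  have hle : ∀ w ∈ Metric.ball (0 : ℂ) R, ‖f w‖ ≤ R := fun w hw => by
    simpa using hm hw
  have hR' : (R : ℂ) ≠ 0 := by exact_mod_cast hR.ne'
  have e0 : discShift R (-a) 0 = a := by
    simp only [discShift]
    push_cast
    field_simp
    simp [mul_comm]
  have eF0 : F 0 = 0 := by
    simp only [hF]
    rw [e0, h1]
    simp [discShift]
  set b : ℂ := discShift R a (-a) with hb
  have hbR : b ∈ Metric.ball (0 : ℂ) R := by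
    rw [mem_ball_zero_iff]
    exact norm_discShift_lt ha hna
  have hb' : discShift R (-a) b = -a := discShift_neg_discShift ha hna.le
  have hFb : F b = b := by
    simp only [hF]
    rw [hb', h2]
  have hb0 : b ≠ 0 := by
    intro h
    rw [h, e0] at hb'
    have : (a : ℂ) = 0 := by linear_combination hb' / 2
    exact ha0 (by exact_mod_cast this)
  have hFd : DifferentiableOn ℂ F (Metric.ball 0 R) := by
    intro w hw
    have h3 := differentiableAt_discShift ha (hle _ (hmem w hw))
    have h4 := hd.differentiableAt (Metric.isOpen_ball.mem_nhds (hmem w hw))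
    have h5 := differentiableAt_discShift ha' (mem_ball_zero_iff.1 hw).le
    exact (h3.comp w (h4.comp w h5)).differentiableWithinAt
  have hFm : MapsTo F (Metric.ball 0 R) (Metric.closedBall (F 0) R) := fun w hw => by
    rw [eF0, mem_closedBall_zero_iff]
    exact norm_discShift_le ha (hle _ (hmem w hw))
  have hsl : dslope F 0 b = 1 := by
    rw [dslope_of_ne _ hb0, slope_def_field, hFb, eF0, sub_zero, div_self hb0]
  have key := Complex.affine_of_mapsTo_ball_of_norm_dslope_eq_div hFd hFm hbR
    (by rw [hsl, div_self hR.ne', norm_one])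
  have hz' := mem_ball_zero_iff.1 hz
  have hs : discShift R a z ∈ Metric.ball (0 : ℂ) R := by
    rw [mem_ball_zero_iff]
    exact norm_discShift_lt ha hz'
  have h3 : F (discShift R a z) = discShift R a z := by
    have := key hs
    simpa only [hsl, eF0, sub_zero, zero_add, smul_eq_mul, mul_one] using this
  have h4 : discShift R a (f z) = discShift R a z := by
    simpa only [hF, discShift_neg_discShift ha hz'.le] using h3
  have h5 := congrArg (discShift R (-a)) h4
  rwa [discShift_neg_discShift ha hz'.le, discShift_neg_discShift ha (hle z hz)] at h5

/-- A linear exponent is eventually beaten by an exponential one. -/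
theorem eventually_mul_le_two_pow (n : ℕ) : ∀ᶠ j : ℕ in atTop, n * j ≤ 2 ^ j := by
  have h : Tendsto (fun j : ℕ => (j : ℝ) ^ 1 / 2 ^ j) atTop (𝓝 0) :=
    tendsto_pow_const_div_const_pow_of_one_lt 1 one_lt_two
  have h' : Tendsto (fun j : ℕ => n * ((j : ℝ) ^ 1 / 2 ^ j)) atTop (𝓝 0) := by
    simpa using h.const_mul (n : ℝ)
  filter_upwards [h'.eventually_lt_const one_pos] with j hj
  have h2 : (0 : ℝ) < 2 ^ j := by positivity
  rw [pow_one, ← mul_div_assoc, div_lt_one h2] at hj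
  exact_mod_cast hj.le

theorem add_two_le_two_pow {k : ℕ} (hk : 2 ≤ k) : k + 2 ≤ 2 ^ k := by
  induction k, hk using Nat.le_induction with
  | base => norm_num
  | succ k hk ih => rw [pow_succ]; omega

theorem radius_le_quarter {k : ℕ} (hk : 2 ≤ k) :
    (1 : ℝ) / 2 ^ (2 ^ k) ≤ 1 / 2 ^ k / 4 := by
  have h : (2 : ℝ) ^ (k + 2) ≤ 2 ^ (2 ^ k) :=
    pow_le_pow_right₀ (by norm_num) (add_two_le_two_pow hk)
  calc (1 : ℝ) / 2 ^ (2 ^ k) ≤ 1 / 2 ^ (k + 2) := by gcongr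
    _ = _ := by rw [pow_add]; field_simp; norm_num

theorem one_div_two_pow_le_half {k l : ℕ} (h : k < l) : (1 : ℝ) / 2 ^ l ≤ 1 / 2 ^ k / 2 := by
  have : (2 : ℝ) ^ (k + 1) ≤ 2 ^ l := pow_le_pow_right₀ (by norm_num) h
  calc (1 : ℝ) / 2 ^ l ≤ 1 / 2 ^ (k + 1) := by gcongr
    _ = _ := by rw [pow_succ]; field_simp

/-- The disc of radius `2 ^ (-2 ^ k)` about `2 ^ (-k)`. -/
def smallDisc (k : ℕ) : Set ℂ := Metric.ball (1 / 2 ^ k) (1 / 2 ^ (2 ^ k))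

theorem norm_one_div_two_pow (k : ℕ) : ‖(1 / 2 ^ k : ℂ)‖ = 1 / 2 ^ k := by simp

theorem le_norm_of_mem_smallDisc {k : ℕ} (hk : 2 ≤ k) {w : ℂ} (hw : w ∈ smallDisc k) :
    3 / 4 * (1 / 2 ^ k) ≤ ‖w‖ := by
  have h1 := radius_le_quarter hk
  have h2 : ‖w - 1 / 2 ^ k‖ < 1 / 2 ^ (2 ^ k) := by simpa [smallDisc, dist_eq_norm] using hw
  have h3 := norm_sub_norm_le (1 / 2 ^ k : ℂ) w
  rw [norm_sub_rev, norm_one_div_two_pow] at h3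
  linarith

theorem norm_le_of_mem_smallDisc {k : ℕ} (hk : 2 ≤ k) {w : ℂ} (hw : w ∈ smallDisc k) :
    ‖w‖ ≤ 5 / 4 * (1 / 2 ^ k) := by
  have h1 := radius_le_quarter hk
  have h2 : ‖w - 1 / 2 ^ k‖ < 1 / 2 ^ (2 ^ k) := by simpa [smallDisc, dist_eq_norm] using hw
  have h3 := norm_sub_norm_le w (1 / 2 ^ k : ℂ)
  rw [norm_one_div_two_pow] at h3
  linarith

/-- The discs with index at least `2` are pairwise disjoint; those with index `1` and `2`
overlap. -/
theorem disjoint_smallDisc {k l : ℕ} (hk : 2 ≤ k) (hl : 2 ≤ l) (h : k ≠ l) :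
    Disjoint (smallDisc k) (smallDisc l) := by
  wlog hkl : k < l generalizing k l
  · exact (this hl hk h.symm (by omega)).symm
  rw [Set.disjoint_left]
  intro w hw hw'
  have h1 := le_norm_of_mem_smallDisc hk hw
  have h2 := norm_le_of_mem_smallDisc hl hw'
  have h3 := one_div_two_pow_le_half hkl
  have h4 : (0 : ℝ) < 1 / 2 ^ k := by positivity
  linarith

/-- Because the discs are pairwise disjoint, a continuous image of one of them inside their union
stays in a single one. -/
theorem exists_mapsTo_smallDisc {j : ℕ} {h : ℂ → ℂ} (hc : ContinuousOn h (smallDisc j))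
    (H : ∀ w ∈ smallDisc j, ∃ k, 2 ≤ k ∧ h w ∈ smallDisc k) :
    ∃ k, 2 ≤ k ∧ MapsTo h (smallDisc j) (smallDisc k) := by
  have hmem : (1 / 2 ^ j : ℂ) ∈ smallDisc j := Metric.mem_ball_self (by positivity)
  obtain ⟨k, hk, hmk⟩ := H _ hmem
  refine ⟨k, hk, ?_⟩
  have hpre : IsPreconnected (h '' smallDisc j) :=
    ((convex_ball _ _).isPreconnected).image h hc
  rw [mapsTo_iff_image_subset]
  refine hpre.subset_left_of_subset_union (v := ⋃ l ∈ {l | 2 ≤ l ∧ k ≠ l}, smallDisc l)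
    Metric.isOpen_ball (isOpen_biUnion fun l _ => Metric.isOpen_ball) ?_ ?_
    ⟨_, mem_image_of_mem h hmem, hmk⟩
  · rw [disjoint_iUnion₂_right]
    exact fun l hl => disjoint_smallDisc hk hl.1 hl.2
  · rintro _ ⟨w, hw, rfl⟩
    obtain ⟨l, hl, hml⟩ := H w hw
    by_cases e : k = l
    · exact Or.inl (e ▸ hml)
    · exact Or.inr (mem_biUnion (show l ∈ {l | 2 ≤ l ∧ k ≠ l} from ⟨hl, e⟩) hml)

theorem tendsto_mul_one_div_two_pow (c : ℝ) :
    Tendsto (fun j : ℕ => c * (1 / 2 ^ j : ℝ)) atTop (𝓝 0) := by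
  have := (tendsto_pow_atTop_nhds_zero_of_lt_one (r := (1 / 2 : ℝ)) (by norm_num)
    (by norm_num)).const_mul c
  simpa [one_div, inv_pow] using this

theorem tendsto_one_div_two_pow : Tendsto (fun j : ℕ => (1 / 2 ^ j : ℂ)) atTop (𝓝 0) := by
  have := tendsto_pow_atTop_nhds_zero_of_norm_lt_one (x := (1 / 2 : ℂ)) (by norm_num)
  simpa [one_div, inv_pow] using this

/-- The thinness of the discs is the point here: they shrink so fast that a holomorphic germ at `0`
mapping them into one another can neither move a disc to a later one (its derivative would be too
small there) nor, being bounded by `1` in derivative, to an earlier one. Hence it preserves each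
disc far out, and has derivative `1`. -/
theorem deriv_eq_one_of_mapsTo_smallDisc {h : ℂ → ℂ} (hh : AnalyticAt ℂ h 0) (h0 : h 0 = 0)
    (hβ : ‖deriv h 0‖ ≤ 1)
    (H : ∀ᶠ j : ℕ in atTop, ∀ w ∈ smallDisc j, ∃ k, 2 ≤ k ∧ h w ∈ smallDisc k) :
    deriv h 0 = 1 := by
  obtain ⟨ε, hε, hball⟩ := Metric.eventually_nhds_iff_ball.1 hh.eventually_analyticAt
  have hsub : ∀ᶠ j : ℕ in atTop, smallDisc j ⊆ Metric.ball 0 ε := by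
    filter_upwards [(tendsto_mul_one_div_two_pow (5 / 4)).eventually_lt_const hε,
      eventually_ge_atTop 2] with j hj hj2 w hw
    rw [mem_ball_zero_iff]
    exact (norm_le_of_mem_smallDisc hj2 hw).trans_lt hj
  have hdiff : DifferentiableOn ℂ h (Metric.ball 0 ε) := fun w hw =>
    (hball w hw).differentiableAt.differentiableWithinAt
  have hk : ∀ᶠ j : ℕ in atTop, ∃ k, 2 ≤ k ∧ MapsTo h (smallDisc j) (smallDisc k) := by
    filter_upwards [H, hsub] with j hj hs
    exact exists_mapsTo_smallDisc (hdiff.continuousOn.mono hs) hj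
  have hne0 : ∀ j : ℕ, (1 / 2 ^ j : ℂ) ≠ 0 := fun j => by simp
  have hmem : ∀ j : ℕ, (1 / 2 ^ j : ℂ) ∈ smallDisc j := fun j =>
    Metric.mem_ball_self (by positivity)
  have hseq : Tendsto (fun j : ℕ => (1 / 2 ^ j : ℂ)) atTop (𝓝[≠] 0) :=
    tendsto_nhdsWithin_iff.2 ⟨tendsto_one_div_two_pow, Eventually.of_forall hne0⟩
  have hquot : Tendsto (fun j : ℕ => h (1 / 2 ^ j) / (1 / 2 ^ j)) atTop (𝓝 (deriv h 0)) := by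
    have := (hasDerivAt_iff_tendsto_slope.1 hh.differentiableAt.hasDerivAt).comp hseq
    refine this.congr fun j => ?_
    simp [slope_def_field, h0]
  -- `h` cannot map the `j`-th disc to an earlier one.
  have hge : ∀ᶠ j : ℕ in atTop, ∀ k, 2 ≤ k → MapsTo h (smallDisc j) (smallDisc k) → j ≤ k := by
    filter_upwards [hquot.norm.eventually_lt_const (lt_of_le_of_lt hβ (by norm_num :
      (1 : ℝ) < 5 / 4))] with j hj k hk hm
    by_contra! hlt
    have h1 := le_norm_of_mem_smallDisc hk (hm (hmem j))
    have h2 := one_div_two_pow_le_half hlt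
    rw [norm_div, norm_one_div_two_pow, div_lt_iff₀ (by positivity)] at hj
    have h4 : (0 : ℝ) < 1 / 2 ^ k := by positivity
    linarith
  have hdne : ¬ ∀ᶠ w in 𝓝 0, deriv h w = 0 := by
    intro hz
    have hd0 : EqOn (deriv h) 0 (Metric.ball 0 ε) := by
      have : AnalyticOnNhd ℂ (deriv h) (Metric.ball 0 ε) := fun w hw => (hball w hw).deriv
      exact this.eqOn_zero_of_preconnected_of_eventuallyEq_zero
        (convex_ball _ _).isPreconnected (Metric.mem_ball_self hε) hz
    obtain ⟨j, ⟨k, hk2, hm⟩, hs⟩ := (hk.and hsub).exists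
    have hcst : h (1 / 2 ^ j) = h 0 :=
      Metric.isOpen_ball.is_const_of_deriv_eq_zero (convex_ball _ _).isPreconnected hdiff hd0
        (hs (hmem j)) (Metric.mem_ball_self hε)
    have := le_norm_of_mem_smallDisc hk2 (hm (hmem j))
    rw [hcst, h0, norm_zero] at this
    have h4 : (0 : ℝ) < 1 / 2 ^ k := by positivity
    linarith
  obtain ⟨n, u, hu, hu0, hfac⟩ := hh.deriv.exists_eventuallyEq_pow_smul_nonzero_iff.2 hdne
  -- By Cauchy's estimate `h` cannot map the `j`-th disc to a later one either.
  have hle : ∀ᶠ j : ℕ in atTop, ∀ k, MapsTo h (smallDisc j) (smallDisc k) → k ≤ j := by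
    have hu' : ∀ᶠ j : ℕ in atTop, ‖u 0‖ / 2 < ‖u (1 / 2 ^ j)‖ :=
      ((hu.continuousAt.tendsto.comp tendsto_one_div_two_pow).norm).eventually_const_lt
        (half_lt_self (norm_pos_iff.2 hu0))
    filter_upwards [hu', tendsto_one_div_two_pow.eventually hfac, hsub,
      eventually_mul_le_two_pow (n + 1),
      (tendsto_mul_one_div_two_pow 2).eventually_lt_const
        (half_pos (norm_pos_iff.2 hu0))] with j h1 h2 h3 h4 h5 k hm
    by_contra! hlt
    have hd := Complex.norm_deriv_le_div_of_mapsTo_ball (c := (1 / 2 ^ j : ℂ))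
      (R₁ := 1 / 2 ^ (2 ^ j)) (R₂ := 2 * (1 / 2 ^ (2 ^ k))) (f := h) (hdiff.mono h3)
      (fun w hw => by
        have e1 := hm hw
        have e2 := hm (hmem j)
        simp only [smallDisc, Metric.mem_ball] at e1 e2
        rw [Metric.mem_closedBall]
        linarith [dist_triangle_right (h w) (h (1 / 2 ^ j)) (1 / 2 ^ k)]) (by positivity)
    rw [h2, sub_zero, smul_eq_mul, norm_mul, norm_pow, norm_one_div_two_pow,
      le_div_iff₀ (by positivity)] at hd
    have h6 : (2 : ℝ) ^ (2 * 2 ^ j) ≤ 2 ^ (2 ^ k) := by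
      refine pow_le_pow_right₀ (by norm_num) ?_
      calc 2 * 2 ^ j = 2 ^ (j + 1) := by rw [pow_succ]; ring
        _ ≤ 2 ^ k := Nat.pow_le_pow_right (by norm_num) hlt
    have h7 : (2 : ℝ) * (1 / 2 ^ (2 ^ k)) ≤ 2 * (1 / 2 ^ (2 * 2 ^ j)) := by gcongr
    have h8 : (2 : ℝ) ^ ((n + 1) * j) ≤ 2 ^ (2 ^ j) := pow_le_pow_right₀ (by norm_num) h4
    have h9 : (1 / 2 ^ j : ℝ) ^ n * ‖u (1 / 2 ^ j)‖ ≤ 2 * (1 / 2 ^ (2 ^ j)) := by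
      have hx : (0 : ℝ) < 1 / 2 ^ (2 ^ j) := by positivity
      refine le_of_mul_le_mul_right ((hd.trans h7).trans_eq ?_) hx
      rw [mul_comm 2 (2 ^ j), pow_mul]
      field_simp
    have h10 : (1 / 2 ^ j : ℝ) ^ n * ‖u (1 / 2 ^ j)‖ ≤ (1 / 2 ^ j : ℝ) ^ n * (2 * (1 / 2 ^ j)) := by
      refine h9.trans ?_
      calc (2 : ℝ) * (1 / 2 ^ (2 ^ j)) ≤ 2 * (1 / 2 ^ ((n + 1) * j)) := by gcongr
        _ = _ := by
          rw [add_mul, one_mul, pow_add, mul_comm n j, pow_mul, one_div_pow]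
          field_simp
    have h11 := le_of_mul_le_mul_left h10 (by positivity)
    linarith
  have hone : Tendsto (fun j : ℕ => h (1 / 2 ^ j) / (1 / 2 ^ j)) atTop (𝓝 1) := by
    rw [tendsto_iff_norm_sub_tendsto_zero]
    have hb : Tendsto (fun j : ℕ => (1 / 2 ^ j : ℝ)) atTop (𝓝 0) := by
      simpa only [one_mul] using tendsto_mul_one_div_two_pow 1
    refine squeeze_zero' (Eventually.of_forall fun _ => norm_nonneg _) ?_ hb
    filter_upwards [hk, hge, hle, eventually_mul_le_two_pow 2] with j ⟨k, hk2, hm⟩ h1 h2 h3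
    obtain rfl : k = j := le_antisymm (h2 k hm) (h1 k hk2 hm)
    have h4 : ‖h (1 / 2 ^ k) - 1 / 2 ^ k‖ < 1 / 2 ^ (2 ^ k) := by
      simpa [smallDisc, dist_eq_norm] using hm (hmem k)
    have h5 : (2 : ℝ) ^ (2 * k) ≤ 2 ^ (2 ^ k) := pow_le_pow_right₀ (by norm_num) h3
    rw [div_sub_one (hne0 k), norm_div, norm_one_div_two_pow, div_le_iff₀ (by positivity)]
    refine h4.le.trans ?_
    calc (1 : ℝ) / 2 ^ (2 ^ k) ≤ 1 / 2 ^ (2 * k) := by gcongr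
      _ = _ := by rw [mul_comm, pow_mul]; field_simp
  exact tendsto_nhds_unique hquot hone

/-! ### Extension from the spherical shell to the ball -/

theorem norm_sq_Cn_two (z : Cn 2) : ‖z‖ ^ 2 = ‖z 0‖ ^ 2 + ‖z 1‖ ^ 2 := by
  rw [EuclideanSpace.norm_sq_eq, Fin.sum_univ_two]

theorem mem_ball_zero_two_iff {z : Cn 2} :
    z ∈ Metric.ball (0 : Cn 2) 2 ↔ ‖z 0‖ ^ 2 + ‖z 1‖ ^ 2 < 4 := by
  rw [mem_ball_zero_iff, ← norm_sq_Cn_two, ← abs_of_nonneg (norm_nonneg z),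
    ← abs_of_pos (two_pos (α := ℝ)), ← sq_lt_sq, sq_abs]
  norm_num

theorem one_lt_norm_iff {z : Cn 2} : 1 < ‖z‖ ↔ 1 < ‖z 0‖ ^ 2 + ‖z 1‖ ^ 2 := by
  rw [← norm_sq_Cn_two, ← one_lt_sq_iff₀ (norm_nonneg z)]

theorem eq_pair (z : Cn 2) : !₂[z 0, z 1] = z := by
  ext i
  fin_cases i <;> rfl

theorem differentiable_pair_left (b : ℂ) : Differentiable ℂ (fun a : ℂ => (!₂[a, b] : Cn 2)) := by
  rw [differentiable_euclidean]
  intro i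
  fin_cases i <;> simp

theorem differentiable_pair_right (a : ℂ) : Differentiable ℂ (fun b : ℂ => (!₂[a, b] : Cn 2)) := by
  rw [differentiable_euclidean]
  intro i
  fin_cases i <;> simp

theorem differentiable_coord (i : Fin 2) : Differentiable ℂ (fun z : Cn 2 => z i) := by
  fun_prop

/-- The spherical shell between the spheres of radius `1` and `2`. -/
def shell : Set (Cn 2) := Metric.ball 0 2 \ Metric.closedBall 0 1

theorem isOpen_shell : IsOpen shell := Metric.isOpen_ball.sdiff Metric.isClosed_closedBall

theorem mem_shell_iff {z : Cn 2} :
    z ∈ shell ↔ ‖z 0‖ ^ 2 + ‖z 1‖ ^ 2 < 4 ∧ 1 < ‖z 0‖ ^ 2 + ‖z 1‖ ^ 2 := by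
  rw [shell, Set.mem_sdiff, mem_ball_zero_two_iff, mem_closedBall_zero_iff, not_le, one_lt_norm_iff]

theorem pair_mem_shell_iff {a b : ℂ} :
    (!₂[a, b] : Cn 2) ∈ shell ↔ ‖a‖ ^ 2 + ‖b‖ ^ 2 < 4 ∧ 1 < ‖a‖ ^ 2 + ‖b‖ ^ 2 := by
  rw [mem_shell_iff]; rfl

/-- The polydisc on which the Cauchy integral over `|ζ| = 8/5` is taken; the circles
`|ζ| = 8/5`, `z₂ = w` with `|w| < 6/5` lie in the shell. -/
def innerPolydisc : Set (Cn 2) := {z | ‖z 0‖ < 8 / 5 ∧ ‖z 1‖ < 6 / 5}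

theorem continuous_norm_coord (i : Fin 2) : Continuous fun z : Cn 2 => ‖z i‖ := by fun_prop

theorem isOpen_innerPolydisc : IsOpen innerPolydisc :=
  (isOpen_lt (continuous_norm_coord 0) continuous_const).inter
    (isOpen_lt (continuous_norm_coord 1) continuous_const)

/-- The Cauchy integral of `g` in the first variable over the circle of radius `8/5`. -/
noncomputable def cauchyExtension (g : Cn 2 → Cn 2) (z : Cn 2) : Cn 2 :=
  (2 * Real.pi * Complex.I : ℂ)⁻¹ • ∮ ζ in C(0, 8 / 5), (ζ - z 0)⁻¹ • g !₂[ζ, z 1]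

theorem pair_circleMap_mem_shell {θ : ℝ} {w : ℂ} (hw : ‖w‖ < 6 / 5) :
    (!₂[circleMap 0 (8 / 5) θ, w] : Cn 2) ∈ shell := by
  have h : ‖circleMap 0 (8 / 5) θ‖ = 8 / 5 := by rw [norm_circleMap_zero]; norm_num
  rw [pair_mem_shell_iff, h]
  constructor <;> nlinarith [norm_nonneg w]

theorem differentiableOn_cauchyExtension {g : Cn 2 → Cn 2} (hg : DifferentiableOn ℂ g shell) :
    DifferentiableOn ℂ (cauchyExtension g) innerPolydisc := by
  have hne : ∀ z ∈ innerPolydisc, ∀ θ, circleMap 0 (8 / 5) θ - z 0 ≠ 0 := by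
    intro z hz θ h
    have h1 : ‖circleMap 0 (8 / 5) θ‖ = 8 / 5 := by rw [norm_circleMap_zero]; norm_num
    rw [sub_eq_zero.1 h] at h1
    exact absurd hz.1 (by rw [h1]; exact lt_irrefl _)
  unfold cauchyExtension circleIntegral
  refine DifferentiableOn.fun_const_smul
    (differentiableOn_intervalIntegral_of_continuousOn isOpen_innerPolydisc _ _ ?_ ?_)
    (2 * Real.pi * Complex.I : ℂ)⁻¹
  · simp only [deriv_circleMap]
    have hcm : Continuous fun x : Cn 2 × ℝ => circleMap 0 (8 / 5) x.2 :=
      (continuous_circleMap 0 _).comp continuous_snd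
    have hz0 : Continuous fun x : Cn 2 × ℝ => x.1 0 := by fun_prop
    have hp : Continuous fun x : Cn 2 × ℝ => (!₂[circleMap 0 (8 / 5) x.2, x.1 1] : Cn 2) := by
      refine (PiLp.continuous_toLp 2 _).comp (continuous_pi fun i => ?_)
      fin_cases i
      · exact hcm
      · exact (by fun_prop : Continuous fun x : Cn 2 × ℝ => x.1 1)
    refine (hcm.mul continuous_const).continuousOn.smul
      (((hcm.sub hz0).continuousOn.inv₀ fun x hx => hne x.1 hx.1 x.2).smul ?_)
    exact hg.continuousOn.comp hp.continuousOn fun x hx => pair_circleMap_mem_shell hx.1.2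
  · intro θ
    have h1 : DifferentiableOn ℂ (fun z : Cn 2 => (circleMap 0 (8 / 5) θ - z 0)⁻¹) innerPolydisc :=
      ((differentiable_const _).sub (differentiable_coord 0)).differentiableOn.inv
        fun z hz => hne z hz θ
    have h2 : DifferentiableOn ℂ (fun z : Cn 2 => g !₂[circleMap 0 (8 / 5) θ, z 1]) innerPolydisc :=
      hg.comp ((differentiable_pair_right _).comp (differentiable_coord 1)).differentiableOn
        fun z hz => pair_circleMap_mem_shell hz.2
    exact (h1.smul h2).const_smul (deriv (circleMap 0 (8 / 5)) θ)

/-- The slices `z₂ = w` with `|w| > 1` avoid the hole of the shell, so that Cauchy's formula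
applies on them. -/
theorem cauchyExtension_eq_of_one_lt_norm_snd {g : Cn 2 → Cn 2} (hg : DifferentiableOn ℂ g shell)
    {z : Cn 2} (hz : z ∈ innerPolydisc) (h1 : 1 < ‖z 1‖) : cauchyExtension g z = g z := by
  have hd : DifferentiableOn ℂ (fun ζ => g !₂[ζ, z 1]) (Metric.closedBall 0 (8 / 5)) := by
    refine hg.comp (differentiable_pair_left _).differentiableOn fun ζ hζ => ?_
    rw [mem_closedBall_zero_iff] at hζ
    have h2 := hz.2
    rw [pair_mem_shell_iff]
    constructor <;> nlinarith [norm_nonneg ζ]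
  have := hd.circleIntegral_sub_inv_smul (w := z 0) (by rw [mem_ball_zero_iff]; exact hz.1)
  rw [cauchyExtension, this, smul_smul, inv_mul_cancel₀ Complex.two_pi_I_ne_zero, one_smul,
    eq_pair]

/-- For fixed `z₁` with `|z₁| > 1` both sides are holomorphic in `z₂`, and they agree where
`|z₂| > 1`. -/
theorem cauchyExtension_eq_of_one_lt_norm_fst {g : Cn 2 → Cn 2} (hg : DifferentiableOn ℂ g shell)
    {z : Cn 2} (hz : z ∈ innerPolydisc) (h1 : 1 < ‖z 0‖) : cauchyExtension g z = g z := by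
  have hmaps : MapsTo (fun w : ℂ => (!₂[z 0, w] : Cn 2)) (Metric.ball 0 (6 / 5)) innerPolydisc :=
    fun w hw => ⟨hz.1, mem_ball_zero_iff.1 hw⟩
  have hmaps' : MapsTo (fun w : ℂ => (!₂[z 0, w] : Cn 2)) (Metric.ball 0 (6 / 5)) shell := by
    intro w hw
    have h2 := hz.1
    rw [mem_ball_zero_iff] at hw
    rw [pair_mem_shell_iff]
    constructor <;> nlinarith [norm_nonneg w]
  have hpd := (differentiable_pair_right (z 0)).differentiableOn (s := Metric.ball 0 (6 / 5))
  have e1 := ((differentiableOn_cauchyExtension hg).comp hpd hmaps)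
  have e2 := hg.comp hpd hmaps'
  -- `11/10` is a point of the disc where the two functions are known to agree nearby.
  have h11 : (11 / 10 : ℂ) ∈ Metric.ball (0 : ℂ) (6 / 5) := by
    rw [mem_ball_zero_iff]; norm_num
  have := eqOn_of_differentiableOn_of_eventuallyEq Metric.isOpen_ball
    (convex_ball (0 : ℂ) (6 / 5)).isPreconnected e1 e2 h11 (by
      have ho : IsOpen {w : ℂ | 1 < ‖w‖} := isOpen_lt continuous_const continuous_norm
      filter_upwards [Metric.isOpen_ball.mem_nhds h11,
        ho.mem_nhds (show (11 / 10 : ℂ) ∈ {w : ℂ | 1 < ‖w‖} by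
          rw [mem_ofPred_eq]; norm_num)] with w hw hw1
      exact cauchyExtension_eq_of_one_lt_norm_snd hg (hmaps hw) hw1)
    (show z 1 ∈ Metric.ball (0 : ℂ) (6 / 5) from mem_ball_zero_iff.2 hz.2)
  simpa [eq_pair] using this

theorem norm_cauchyExtension_le {g : Cn 2 → Cn 2} (hg : DifferentiableOn ℂ g shell) {M : ℝ}
    (hM : ∀ z ∈ shell, ‖g z‖ ≤ M) {z : Cn 2} (hz : z ∈ innerPolydisc) :
    ‖cauchyExtension g z‖ ≤ M := by
  have hz2 := hz.2
  -- The bound holds for `1 < |ζ| < 8/5`, hence inside by the maximum principle.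
  have hbd : ∀ ζ : ℂ, 1 < ‖ζ‖ → ‖ζ‖ < 8 / 5 → ‖cauchyExtension g !₂[ζ, z 1]‖ ≤ M := by
    intro ζ h1 h2
    have hin : (!₂[ζ, z 1] : Cn 2) ∈ innerPolydisc := ⟨h2, hz2⟩
    rw [cauchyExtension_eq_of_one_lt_norm_fst hg hin h1]
    refine hM _ (pair_mem_shell_iff.2 ?_)
    constructor <;> nlinarith [norm_nonneg (z 1)]
  rcases lt_or_ge 1 ‖z 0‖ with h | h
  · simpa [eq_pair] using hbd (z 0) h hz.1
  have hd : DiffContOnCl ℂ (fun ζ => cauchyExtension g !₂[ζ, z 1]) (Metric.ball 0 (13 / 10)) := by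
    refine DifferentiableOn.diffContOnCl_ball (U := Metric.ball 0 (8 / 5)) ?_
      (Metric.closedBall_subset_ball (by norm_num))
    exact (differentiableOn_cauchyExtension hg).comp (differentiable_pair_left _).differentiableOn
      fun ζ hζ => ⟨mem_ball_zero_iff.1 hζ, hz2⟩
  have := Complex.norm_le_of_forall_mem_frontier_norm_le Metric.isBounded_ball hd (C := M)
    (fun ζ hζ => by
      rw [frontier_ball _ (by norm_num), mem_sphere_zero_iff_norm] at hζ
      exact hbd ζ (by rw [hζ]; norm_num) (by rw [hζ]; norm_num))
    (subset_closure (mem_ball_zero_iff.2 (h.trans_lt (by norm_num)) :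
      z 0 ∈ Metric.ball (0 : ℂ) (13 / 10)))
  simpa [eq_pair] using this

/-- The special case of Hartogs' extension theorem needed here: a bounded holomorphic map on the
spherical shell extends to the whole ball, with the same bound. -/
theorem exists_extension_of_shell {g : Cn 2 → Cn 2} (hg : DifferentiableOn ℂ g shell)
    {M : ℝ} (hM : ∀ z ∈ shell, ‖g z‖ ≤ M) :
    ∃ Φ : Cn 2 → Cn 2, DifferentiableOn ℂ Φ (Metric.ball 0 2) ∧
      (∀ z ∈ Metric.ball (0 : Cn 2) 2, ‖Φ z‖ ≤ M) ∧
      ∀ z ∈ Metric.ball (0 : Cn 2) 2, 1 < ‖z 0‖ ∨ 1 < ‖z 1‖ → Φ z = g z := by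
  classical
  let Φ : Cn 2 → Cn 2 := fun z => if z ∈ innerPolydisc then cauchyExtension g z else g z
  have hin : ∀ z ∈ innerPolydisc, Φ z = cauchyExtension g z := fun z hz => if_pos hz
  have hout : ∀ z, 1 < ‖z 0‖ ∨ 1 < ‖z 1‖ → Φ z = g z := by
    intro z h
    by_cases hz : z ∈ innerPolydisc
    · rw [hin z hz]
      exact h.elim (cauchyExtension_eq_of_one_lt_norm_fst hg hz)
        (cauchyExtension_eq_of_one_lt_norm_snd hg hz)
    · exact if_neg hz
  have hcase : ∀ z, z ∉ innerPolydisc → 1 < ‖z 0‖ ∨ 1 < ‖z 1‖ := by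
    intro z hz
    by_contra! hc
    exact hz ⟨hc.1.trans_lt (by norm_num), hc.2.trans_lt (by norm_num)⟩
  have hshell : ∀ z ∈ Metric.ball (0 : Cn 2) 2, 1 < ‖z 0‖ ∨ 1 < ‖z 1‖ → z ∈ shell := by
    intro z hz h
    refine mem_shell_iff.2 ⟨mem_ball_zero_two_iff.1 hz, ?_⟩
    rcases h with h | h <;> nlinarith [norm_nonneg (z 0), norm_nonneg (z 1)]
  refine ⟨Φ, fun z hz => ?_, fun z hz => ?_, fun z _ h => hout z h⟩
  · refine DifferentiableAt.differentiableWithinAt ?_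
    by_cases hzP : z ∈ innerPolydisc
    · have hn := isOpen_innerPolydisc.mem_nhds hzP
      exact ((differentiableOn_cauchyExtension hg).differentiableAt hn).congr_of_eventuallyEq
        (eventually_of_mem hn hin)
    · have h := hcase z hzP
      have ho : IsOpen {z : Cn 2 | 1 < ‖z 0‖ ∨ 1 < ‖z 1‖} :=
        (isOpen_lt continuous_const (continuous_norm_coord 0)).union
          (isOpen_lt continuous_const (continuous_norm_coord 1))
      exact (hg.differentiableAt (isOpen_shell.mem_nhds (hshell z hz h))).congr_of_eventuallyEq
        (eventually_of_mem (ho.mem_nhds h) hout)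
  · by_cases hzP : z ∈ innerPolydisc
    · rw [hin z hzP]
      exact norm_cauchyExtension_le hg hM hzP
    · rw [hout z (hcase z hzP)]
      exact hM z (hshell z hz (hcase z hzP))

/-! ### Geometry of the domain -/

theorem mem_ball_pair_iff {z : Cn 2} {a b : ℂ} {r : ℝ} (hr : 0 < r) :
    z ∈ Metric.ball (!₂[a, b] : Cn 2) r ↔ ‖z 0 - a‖ ^ 2 + ‖z 1 - b‖ ^ 2 < r ^ 2 := by
  have h := norm_sq_Cn_two (z - !₂[a, b])
  simp only [PiLp.sub_apply] at h
  rw [mem_ball_iff_norm, ← sq_lt_sq₀ (norm_nonneg _) hr.le, h]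
  rfl

theorem shell_subset_exampleDomain : shell ⊆ exampleDomain := fun z hz => by
  refine Or.inl (Or.inl (Or.inl ⟨hz.1, ?_⟩))
  rw [closure_ball _ one_ne_zero]
  exact hz.2

theorem isOpen_bidisc (j : ℕ) : IsOpen (bidisc j) :=
  (isOpen_lt (continuous_norm_coord 0) continuous_const).inter
    (isOpen_lt (f := fun z : Cn 2 => ‖z 1 - 1 / 2 ^ j‖) (by fun_prop) continuous_const)

theorem isOpen_exampleDomain : IsOpen exampleDomain :=
  (((Metric.isOpen_ball.sdiff isClosed_closure).union Metric.isOpen_ball).union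
    (Metric.isOpen_ball.inter Metric.isOpen_ball)).union
    (isOpen_iUnion fun j => isOpen_iUnion fun _ => isOpen_bidisc j)

theorem bidisc_subset_exampleDomain {j : ℕ} (hj : 1 ≤ j) : bidisc j ⊆ exampleDomain :=
  fun _ hz => Or.inr (mem_iUnion₂.2 ⟨j, hj, hz⟩)

theorem norm_snd_lt_of_mem_bidisc {j : ℕ} (hj : 1 ≤ j) {z : Cn 2} (hz : z ∈ bidisc j) :
    ‖z 1‖ < 3 / 4 := by
  have h1 : (1 : ℝ) / 2 ^ j ≤ 1 / 2 ^ 1 :=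
    one_div_le_one_div_of_le (by positivity) (pow_le_pow_right₀ (by norm_num) hj)
  have h2 : (1 : ℝ) / 2 ^ (2 ^ j) ≤ 1 / 2 ^ (2 ^ 1) :=
    one_div_le_one_div_of_le (by positivity)
      (pow_le_pow_right₀ (by norm_num) (Nat.pow_le_pow_right (by norm_num) hj))
  have h3 := norm_sub_norm_le (z 1) (1 / 2 ^ j : ℂ)
  rw [norm_one_div_two_pow] at h3
  have h4 := hz.2
  rw [pow_one] at h1
  rw [show (1 : ℝ) / 2 ^ (2 ^ 1) = 1 / 4 by norm_num] at h2
  linarith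

theorem exampleDomain_subset_ball : exampleDomain ⊆ Metric.ball 0 2 := by
  rintro z (((hz | hz) | hz) | hz)
  · exact hz.1
  · rw [mem_ball_iff_norm] at hz
    have h : ‖(!₂[0, -1] : Cn 2)‖ = 1 := by simp [EuclideanSpace.norm_eq]
    rw [mem_ball_zero_iff]
    have := norm_sub_norm_le z (!₂[0, -1] : Cn 2)
    rw [h] at this
    norm_num at hz
    linarith
  · exact hz.2
  · obtain ⟨j, hj, hz⟩ := mem_iUnion₂.1 hz
    have h1 := norm_snd_lt_of_mem_bidisc hj hz
    have h2 := hz.1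
    rw [mem_ball_zero_two_iff]
    nlinarith [norm_nonneg (z 0), norm_nonneg (z 1)]

/-- Close to the origin the domain consists of the bidiscs only: there `b₁` and `b₂` are missing,
the latter because its centre is displaced in the `z₁`-direction. -/
theorem exists_mem_bidisc_of_norm_lt {z : Cn 2} (hz : z ∈ exampleDomain)
    (h : ‖z‖ < 1 / 10 ^ 5) : ∃ k, 2 ≤ k ∧ z ∈ bidisc k := by
  have h0 : ‖z 0‖ < 1 / 10 ^ 5 := (PiLp.norm_apply_le z 0).trans_lt h
  have h1 : ‖z 1‖ < 1 / 10 ^ 5 := (PiLp.norm_apply_le z 1).trans_lt h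
  have h2 : 1 - 1 / 10 ^ 5 < ‖z 1 - -1‖ := by
    have := norm_sub_norm_le (1 : ℂ) (-z 1)
    rw [norm_one, norm_neg, show (1 : ℂ) - -z 1 = z 1 - -1 by ring] at this
    linarith
  rcases hz with ((hz | hz) | hz) | hz
  · refine absurd (subset_closure ?_) hz.2
    rw [mem_ball_zero_iff]
    exact h.trans (by norm_num)
  · rw [mem_ball_pair_iff (by norm_num)] at hz
    norm_num at hz h2
    nlinarith [sq_nonneg ‖z 0‖]
  · have hz' := (mem_ball_pair_iff one_pos).1 hz.1
    have h3 : 1 / 50 - 1 / 10 ^ 5 < ‖z 0 - 1 / 50‖ := by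
      have := norm_sub_norm_le (1 / 50 : ℂ) (z 0)
      rw [norm_sub_rev] at this
      norm_num at this ⊢
      norm_num at h0
      linarith
    norm_num at hz' h2 h3
    nlinarith
  · obtain ⟨k, hk, hz⟩ := mem_iUnion₂.1 hz
    refine ⟨k, ?_, hz⟩
    by_contra! hk2
    obtain rfl : k = 1 := by omega
    have h3 := hz.2
    have h4 := norm_sub_norm_le (1 / 2 ^ 1 : ℂ) (z 1)
    rw [norm_one_div_two_pow, norm_sub_rev] at h4
    norm_num at h1 h3 h4
    linarith

/-- Over each point of `smallDisc j` the slice of the domain is a full disc. -/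
theorem mem_exampleDomain_of_snd_mem_smallDisc {j : ℕ} (hj : 1 ≤ j) {z : Cn 2}
    (hz : z ∈ Metric.ball (0 : Cn 2) 2) (h : z 1 ∈ smallDisc j) : z ∈ exampleDomain := by
  rcases lt_or_ge ‖z 0‖ (3 / 2) with h0 | h0
  · refine bidisc_subset_exampleDomain hj ⟨h0, ?_⟩
    simpa [smallDisc, dist_eq_norm] using h
  · refine shell_subset_exampleDomain (mem_shell_iff.2 ⟨mem_ball_zero_two_iff.1 hz, ?_⟩)
    nlinarith [sq_nonneg ‖z 1‖]

theorem disc_subset_exampleDomain {j : ℕ} (hj : 1 ≤ j) : disc j ⊆ exampleDomain :=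
  fun z hz => mem_exampleDomain_of_snd_mem_smallDisc hj hz.1 (by
    rw [hz.2]
    exact Metric.mem_ball_self (by positivity))

theorem isPreconnected_shell : IsPreconnected shell := by
  have hs : IsPreconnected (Metric.sphere (0 : Cn 2) 1) := by
    refine isPreconnected_sphere ?_ _ _
    have : Module.finrank ℝ (Cn 2) = 4 := by
      rw [finrank_real_of_complex, finrank_euclideanSpace]
      simp
    rw [← Module.finrank_eq_rank, this]
    norm_num
  have h := (hs.prod (isPreconnected_Ioo (a := (1 : ℝ)) (b := 2))).image
    (fun x : Cn 2 × ℝ => x.2 • x.1) (by fun_prop)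
  convert h
  ext z
  constructor
  · rintro ⟨h2, h1⟩
    rw [mem_ball_zero_iff] at h2
    rw [mem_closedBall_zero_iff, not_le] at h1
    have h0 : ‖z‖ ≠ 0 := by positivity
    refine ⟨(‖z‖⁻¹ • z, ‖z‖), ⟨?_, h1, h2⟩, ?_⟩
    · rw [mem_sphere_zero_iff_norm, norm_smul, norm_inv, norm_norm, inv_mul_cancel₀ h0]
    · simp [smul_smul, mul_inv_cancel₀ h0]
  · rintro ⟨⟨x, t⟩, ⟨hx, ht1, ht2⟩, rfl⟩
    rw [mem_sphere_zero_iff_norm] at hx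
    have e : ‖t • x‖ = t := by
      rw [norm_smul, hx, mul_one, Real.norm_eq_abs, abs_of_pos (by linarith)]
    refine ⟨?_, ?_⟩
    · rw [mem_ball_zero_iff, e]; exact ht2
    · rw [mem_closedBall_zero_iff, e, not_le]; exact ht1

theorem isPreconnected_bidisc (j : ℕ) : IsPreconnected (bidisc j) := by
  have h0 : Convex ℝ ((fun z : Cn 2 => z 0) ⁻¹' Metric.ball 0 (3 / 2)) :=
    (convex_ball (0 : ℂ) (3 / 2)).is_linear_preimage ⟨fun _ _ => rfl, fun _ _ => rfl⟩
  have h1 : Convex ℝ ((fun z : Cn 2 => z 1) ⁻¹' Metric.ball (1 / 2 ^ j) (1 / 2 ^ (2 ^ j))) :=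
    (convex_ball (1 / 2 ^ j : ℂ) _).is_linear_preimage ⟨fun _ _ => rfl, fun _ _ => rfl⟩
  convert (h0.inter h1).isPreconnected using 1
  ext z
  simp [bidisc, dist_eq_norm]

theorem isConnected_exampleDomain : IsConnected exampleDomain := by
  have hx : (!₂[0, -(3 / 2)] : Cn 2) ∈ shell := by
    rw [pair_mem_shell_iff]
    norm_num
  refine ⟨⟨_, shell_subset_exampleDomain hx⟩, ?_⟩
  refine isPreconnected_of_forall (!₂[0, -(3 / 2)] : Cn 2) ?_
  have hshell : ∀ {s : Set (Cn 2)} {y : Cn 2}, IsPreconnected s → s ⊆ exampleDomain →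
      y ∈ s → (shell ∩ s).Nonempty →
      ∃ t ⊆ exampleDomain, (!₂[0, -(3 / 2)] : Cn 2) ∈ t ∧ y ∈ t ∧ IsPreconnected t := by
    intro s y hs hsub hy hne
    exact ⟨shell ∪ s, union_subset shell_subset_exampleDomain hsub, Or.inl hx, Or.inr hy,
      isPreconnected_shell.union' hne hs⟩
  rintro y (((hy | hy) | hy) | hy)
  · refine ⟨shell, shell_subset_exampleDomain, hx, ?_, isPreconnected_shell⟩
    rw [closure_ball _ one_ne_zero] at hy
    exact hy
  · refine hshell (convex_ball _ _).isPreconnected (fun z hz => Or.inl (Or.inl (Or.inr hz))) hy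
      ⟨_, hx, (mem_ball_pair_iff (by norm_num)).2 ?_⟩
    norm_num
  · refine hshell ((convex_ball _ _).inter (convex_ball _ _)).isPreconnected
      (fun z hz => Or.inl (Or.inr hz)) hy ⟨_, hx, (mem_ball_pair_iff one_pos).2 ?_, hx.1⟩
    norm_num
  · obtain ⟨j, hj, hy⟩ := mem_iUnion₂.1 hy
    have hm : (!₂[7 / 5, 1 / 2 ^ j] : Cn 2) ∈ bidisc j := by
      constructor
      · norm_num
      · simp
    refine hshell (isPreconnected_bidisc j) (bidisc_subset_exampleDomain hj) hy ⟨_, ?_, hm⟩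
    have h1 := norm_snd_lt_of_mem_bidisc hj hm
    change ‖(1 / 2 ^ j : ℂ)‖ < 3 / 4 at h1
    rw [pair_mem_shell_iff, show ‖(7 / 5 : ℂ)‖ = 7 / 5 by norm_num]
    constructor <;> nlinarith [norm_nonneg (1 / 2 ^ j : ℂ)]

theorem isBoundedDomain_exampleDomain : IsBoundedDomain exampleDomain :=
  ⟨isOpen_exampleDomain, isConnected_exampleDomain,
    Metric.isBounded_ball.subset exampleDomain_subset_ball⟩

/-! ### Maps of the domain fixing two points -/

/-- On the slices over `smallDisc j` the extension still agrees with the given map, although the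
slice crosses the hole of the shell. -/
theorem extension_eq_on_smallDisc {g Φ : Cn 2 → Cn 2} (hg : DifferentiableOn ℂ g exampleDomain)
    (hΦ : DifferentiableOn ℂ Φ (Metric.ball 0 2))
    (h : ∀ z ∈ Metric.ball (0 : Cn 2) 2, 1 < ‖z 0‖ ∨ 1 < ‖z 1‖ → Φ z = g z)
    {j : ℕ} (hj : 1 ≤ j) {z : Cn 2} (hz : z ∈ Metric.ball (0 : Cn 2) 2)
    (hzj : z 1 ∈ smallDisc j) (hz1 : ‖z 1‖ < 3 / 2) : Φ z = g z := by
  rcases lt_or_ge 1 ‖z 0‖ with h0 | h0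
  · exact h z hz (Or.inl h0)
  have hmaps : MapsTo (fun ζ : ℂ => (!₂[ζ, z 1] : Cn 2)) (Metric.ball 0 (6 / 5))
      (Metric.ball 0 2) := fun ζ hζ => by
    rw [mem_ball_zero_iff] at hζ
    rw [mem_ball_zero_two_iff]
    change ‖ζ‖ ^ 2 + ‖z 1‖ ^ 2 < 4
    nlinarith [norm_nonneg ζ, norm_nonneg (z 1)]
  have hpd := (differentiable_pair_left (z 1)).differentiableOn (s := Metric.ball 0 (6 / 5))
  have hmaps' : MapsTo (fun ζ : ℂ => (!₂[ζ, z 1] : Cn 2)) (Metric.ball 0 (6 / 5))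
      exampleDomain := fun ζ hζ => mem_exampleDomain_of_snd_mem_smallDisc hj (hmaps hζ) hzj
  -- `11/10` is a point of the disc where the two functions are known to agree nearby.
  have h11 : (11 / 10 : ℂ) ∈ Metric.ball (0 : ℂ) (6 / 5) := by
    rw [mem_ball_zero_iff]; norm_num
  have := eqOn_of_differentiableOn_of_eventuallyEq Metric.isOpen_ball
    (convex_ball (0 : ℂ) (6 / 5)).isPreconnected (hΦ.comp hpd hmaps) (hg.comp hpd hmaps') h11 (by
      have ho : IsOpen {w : ℂ | 1 < ‖w‖} := isOpen_lt continuous_const continuous_norm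
      filter_upwards [Metric.isOpen_ball.mem_nhds h11,
        ho.mem_nhds (show (11 / 10 : ℂ) ∈ {w : ℂ | 1 < ‖w‖} by
          rw [mem_ofPred_eq]; norm_num)] with w hw hw1
      exact h _ (hmaps hw) (Or.inl hw1))
    (show z 0 ∈ Metric.ball (0 : ℂ) (6 / 5) from
      mem_ball_zero_iff.2 (h0.trans_lt (by norm_num)))
  simpa [eq_pair] using this

theorem pair_zero_mem_ball {ζ : ℂ} (hζ : ‖ζ‖ < 2) : (!₂[ζ, 0] : Cn 2) ∈ Metric.ball 0 2 := by
  rw [mem_ball_zero_two_iff]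
  change ‖ζ‖ ^ 2 + ‖(0 : ℂ)‖ ^ 2 < 4
  rw [norm_zero]
  nlinarith [norm_nonneg ζ]

theorem zero_pair_mem_ball {w : ℂ} (hw : ‖w‖ < 2) : (!₂[0, w] : Cn 2) ∈ Metric.ball 0 2 := by
  rw [mem_ball_zero_two_iff]
  change ‖(0 : ℂ)‖ ^ 2 + ‖w‖ ^ 2 < 4
  rw [norm_zero]
  nlinarith [norm_nonneg w]

/-- A holomorphic self-map of the ball fixing two points `(±a, 0)` fixes the disc `z₂ = 0`
pointwise: its first component does by the two-point lemma, and then nothing is left for the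
second one at the boundary. -/
theorem fixes_disc_of_two_fixed_points {Φ : Cn 2 → Cn 2}
    (hΦ : DifferentiableOn ℂ Φ (Metric.ball 0 2))
    (hb : ∀ z ∈ Metric.ball (0 : Cn 2) 2, ‖Φ z‖ ≤ 2) {a : ℝ} (ha0 : a ≠ 0) (ha : |a| < 2)
    (h1 : Φ !₂[(a : ℂ), 0] = !₂[(a : ℂ), 0]) (h2 : Φ !₂[-(a : ℂ), 0] = !₂[-(a : ℂ), 0])
    {ζ : ℂ} (hζ : ‖ζ‖ < 2) : Φ !₂[ζ, 0] = !₂[ζ, 0] := by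
  have hd : DifferentiableOn ℂ (fun ζ : ℂ => Φ !₂[ζ, 0]) (Metric.ball 0 2) :=
    hΦ.comp (differentiable_pair_left 0).differentiableOn
      fun ζ hζ => pair_zero_mem_ball (mem_ball_zero_iff.1 hζ)
  have hd' := fun i : Fin 2 => differentiableOn_euclidean.1 hd i
  have hle : ∀ ζ : ℂ, ‖ζ‖ < 2 → ‖Φ !₂[ζ, 0]‖ ≤ 2 := fun ζ hζ => hb _ (pair_zero_mem_ball hζ)
  have hfst : ∀ ζ : ℂ, ‖ζ‖ < 2 → Φ !₂[ζ, 0] 0 = ζ := by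
    intro ζ hζ
    refine eq_id_of_two_fixed_points (f := fun ζ => Φ !₂[ζ, 0] 0) ha0 ha (hd' 0) (fun ζ hζ => ?_)
      (by simp [h1]) (by simp [h2]) (mem_ball_zero_iff.2 hζ)
    rw [mem_closedBall_zero_iff]
    exact (PiLp.norm_apply_le _ _).trans (hle ζ (mem_ball_zero_iff.1 hζ))
  have hsnd : Φ !₂[ζ, 0] 1 = 0 := by
    have hsq : ∀ ξ : ℂ, ‖ξ‖ < 2 → ‖Φ !₂[ξ, 0] 1‖ ^ 2 ≤ 4 - ‖ξ‖ ^ 2 := by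
      intro ξ hξ
      have e := norm_sq_Cn_two (Φ !₂[ξ, 0])
      rw [hfst ξ hξ] at e
      nlinarith [hle ξ hξ, norm_nonneg (Φ !₂[ξ, 0])]
    have hr : ∀ r : ℝ, ‖ζ‖ < r → r < 2 → ‖Φ !₂[ζ, 0] 1‖ ≤ √(4 - r ^ 2) := by
      intro r h1 h2
      have hr0 : 0 < r := (norm_nonneg _).trans_lt h1
      refine Complex.norm_le_of_forall_mem_frontier_norm_le (f := fun ζ => Φ !₂[ζ, 0] 1)
        Metric.isBounded_ball ((hd' 1).diffContOnCl_ball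
          (Metric.closedBall_subset_ball h2)) (fun ξ hξ => ?_)
        (subset_closure (mem_ball_zero_iff.2 h1))
      rw [frontier_ball _ hr0.ne', mem_sphere_zero_iff_norm] at hξ
      refine Real.le_sqrt_of_sq_le ?_
      have := hsq ξ (by rwa [hξ])
      rwa [hξ] at this
    have ht : Tendsto (fun r : ℝ => √(4 - r ^ 2)) (𝓝[<] 2) (𝓝 0) := by
      have hc : Continuous fun r : ℝ => √(4 - r ^ 2) := by fun_prop
      have := hc.tendsto 2
      norm_num at this
      exact this.mono_left nhdsWithin_le_nhds
    have := ge_of_tendsto ht (by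
      filter_upwards [Ioo_mem_nhdsLT hζ] with r hr'
      exact hr r hr'.1 hr'.2)
    exact norm_le_zero_iff.1 this
  rw [← eq_pair (Φ !₂[ζ, 0]), hfst ζ hζ, hsnd]

/-- Cartan's uniqueness theorem for the ball, by the equality case of the Schwarz lemma on each
complex line through the origin. -/
theorem eq_id_of_fderiv_zero_eq_id {Φ : Cn 2 → Cn 2} {R : ℝ} (hR : 0 < R)
    (hΦ : DifferentiableOn ℂ Φ (Metric.ball 0 R))
    (hb : ∀ z ∈ Metric.ball (0 : Cn 2) R, ‖Φ z‖ ≤ R) (h0 : Φ 0 = 0)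
    (h1 : HasFDerivAt Φ (ContinuousLinearMap.id ℂ (Cn 2)) 0) {z : Cn 2}
    (hz : z ∈ Metric.ball (0 : Cn 2) R) : Φ z = z := by
  rcases eq_or_ne z 0 with rfl | hz0
  · exact h0
  have hzn : 0 < ‖z‖ := norm_pos_iff.2 hz0
  have hzR := mem_ball_zero_iff.1 hz
  have hmaps : MapsTo (fun t : ℂ => t • z) (Metric.ball 0 (R / ‖z‖)) (Metric.ball 0 R) := by
    intro t ht
    rw [mem_ball_zero_iff] at ht ⊢
    rwa [norm_smul, ← lt_div_iff₀ hzn]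
  set F : ℂ → Cn 2 := fun t => Φ (t • z) with hF
  have hF0 : F 0 = 0 := by simp [hF, h0]
  have hFd : DifferentiableOn ℂ F (Metric.ball 0 (R / ‖z‖)) :=
    hΦ.comp (Differentiable.differentiableOn (by fun_prop)) hmaps
  have hFm : MapsTo F (Metric.ball 0 (R / ‖z‖)) (Metric.closedBall (F 0) R) := fun t ht => by
    rw [hF0, mem_closedBall_zero_iff]
    exact hb _ (hmaps ht)
  have hderiv : deriv F 0 = z := by
    have h2 : HasDerivAt (fun t : ℂ => t • z) z 0 := by
      simpa using (hasDerivAt_id (0 : ℂ)).smul_const z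
    have h3 : HasFDerivAt Φ (ContinuousLinearMap.id ℂ (Cn 2)) ((0 : ℂ) • z) := by
      rwa [zero_smul]
    exact (h3.comp_hasDerivAt 0 h2).deriv
  have key := Complex.affine_of_mapsTo_ball_of_norm_dslope_eq_div hFd hFm
    (Metric.mem_ball_self (by positivity)) (by
      rw [dslope_same, hderiv, div_div_cancel₀ hR.ne'])
  have := key (show (1 : ℂ) ∈ Metric.ball (0 : ℂ) (R / ‖z‖) by
    rw [mem_ball_zero_iff, norm_one, one_lt_div hzn]
    exact hzR)
  beta_reduce at this
  rw [hF0, dslope_same, hderiv, zero_add, sub_zero, one_smul] at this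
  simpa [hF] using this

theorem hasDerivAt_Cn_iff {n : ℕ} {f : ℂ → Cn n} {f' : Cn n} {x : ℂ} :
    HasDerivAt f f' x ↔ ∀ i, HasDerivAt (fun t => f t i) (f' i) x := by
  simp only [← hasDerivWithinAt_univ, hasDerivWithinAt_iff_hasFDerivWithinAt,
    hasFDerivWithinAt_euclidean]
  refine forall_congr' fun i => ?_
  congr!

/-- The heart of the matter: a holomorphic self-map of the domain that fixes `p₀` and `q₀` is the
identity. -/
theorem eq_id_of_fixes_pLim_qLim {g : Cn 2 → Cn 2} (hg : IsHolEndo exampleDomain g)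
    (hp : g pLim = pLim) (hq : g qLim = qLim) {z : Cn 2} (hz : z ∈ exampleDomain) : g z = z := by
  obtain ⟨Φ, hΦ, hb, heq⟩ := exists_extension_of_shell
    (hg.1.mono shell_subset_exampleDomain) (M := 2) fun z hz =>
      (mem_ball_zero_iff.1 (exampleDomain_subset_ball
        (hg.2 (shell_subset_exampleDomain hz)))).le
  have hax : ∀ ζ : ℂ, ‖ζ‖ < 2 → Φ !₂[ζ, 0] = !₂[ζ, 0] := by
    intro ζ hζ
    have e1 : (!₂[((3 / 2 : ℝ) : ℂ), 0] : Cn 2) = qLim := by simp [qLim]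
    have e2 : (!₂[-((3 / 2 : ℝ) : ℂ), 0] : Cn 2) = pLim := by simp [pLim]
    have hn : ‖(3 / 2 : ℂ)‖ = 3 / 2 := by norm_num
    refine fixes_disc_of_two_fixed_points hΦ hb (a := 3 / 2) (by norm_num)
      (by rw [abs_of_pos] <;> norm_num) ?_ ?_ hζ
    · rw [e1, heq qLim (pair_zero_mem_ball (by rw [hn]; norm_num)) (Or.inl ?_), hq]
      change 1 < ‖(3 / 2 : ℂ)‖
      rw [hn]; norm_num
    · rw [e2, heq pLim (pair_zero_mem_ball (by rw [norm_neg, hn]; norm_num)) (Or.inl ?_), hp]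
      change 1 < ‖(-(3 / 2) : ℂ)‖
      rw [norm_neg, hn]; norm_num
  have hzero : (!₂[0, 0] : Cn 2) = 0 := eq_pair 0
  have h0 : Φ 0 = 0 := by
    have := hax 0 (by norm_num)
    rwa [hzero] at this
  have hball0 : (0 : Cn 2) ∈ Metric.ball (0 : Cn 2) 2 := Metric.mem_ball_self two_pos
  have hΦ0 : HasFDerivAt Φ (fderiv ℂ Φ 0) 0 :=
    (hΦ.differentiableAt (Metric.isOpen_ball.mem_nhds hball0)).hasFDerivAt
  -- The derivative along the first axis.
  have hd1 : HasDerivAt (fun ζ : ℂ => (!₂[ζ, 0] : Cn 2)) !₂[1, 0] 0 := by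
    rw [hasDerivAt_Cn_iff]
    intro i
    fin_cases i
    · exact hasDerivAt_id _
    · exact hasDerivAt_const _ _
  have hd2 : HasDerivAt (fun w : ℂ => (!₂[0, w] : Cn 2)) !₂[0, 1] 0 := by
    rw [hasDerivAt_Cn_iff]
    intro i
    fin_cases i
    · exact hasDerivAt_const _ _
    · exact hasDerivAt_id _
  have hD1 : fderiv ℂ Φ 0 !₂[1, 0] = !₂[1, 0] := by
    have h1 : HasDerivAt (fun ζ : ℂ => Φ !₂[ζ, 0]) (fderiv ℂ Φ 0 !₂[1, 0]) 0 :=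
      HasFDerivAt.comp_hasDerivAt (l := Φ) 0 (by rwa [hzero]) hd1
    refine h1.unique (hd1.congr_of_eventuallyEq ?_)
    filter_upwards [Metric.ball_mem_nhds (0 : ℂ) two_pos] with ζ hζ
    exact hax ζ (mem_ball_zero_iff.1 hζ)
  -- The derivative along the second axis has norm at most `1` and second component `1`.
  have h2 : HasDerivAt (fun w : ℂ => Φ !₂[0, w]) (fderiv ℂ Φ 0 !₂[0, 1]) 0 :=
    HasFDerivAt.comp_hasDerivAt (l := Φ) 0 (by rwa [hzero]) hd2
  have hψ : DifferentiableOn ℂ (fun w : ℂ => Φ !₂[0, w]) (Metric.ball 0 2) :=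
    hΦ.comp (differentiable_pair_right 0).differentiableOn
      fun w hw => zero_pair_mem_ball (mem_ball_zero_iff.1 hw)
  have hnorm : ‖fderiv ℂ Φ 0 !₂[0, 1]‖ ≤ 1 := by
    rw [← h2.deriv]
    refine Complex.norm_deriv_le_one_of_mapsTo_ball hψ (fun w hw => ?_) two_pos
    rw [hzero, h0, mem_closedBall_zero_iff]
    exact hb _ (zero_pair_mem_ball (mem_ball_zero_iff.1 hw))
  have hψ1 := differentiableOn_euclidean.1 hψ 1
  have h21 : HasDerivAt (fun w : ℂ => Φ !₂[0, w] 1) (fderiv ℂ Φ 0 !₂[0, 1] 1) 0 :=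
    hasDerivAt_Cn_iff.1 h2 1
  have hsnd : fderiv ℂ Φ 0 !₂[0, 1] 1 = 1 := by
    rw [← h21.deriv]
    refine deriv_eq_one_of_mapsTo_smallDisc
      (hψ1.analyticAt (Metric.ball_mem_nhds _ two_pos)) (by rw [hzero, h0]; rfl) ?_ ?_
    · rw [h21.deriv]
      exact (PiLp.norm_apply_le _ _).trans hnorm
    · have hc : Tendsto (fun w : ℂ => ‖Φ !₂[0, w]‖) (𝓝 0) (𝓝 0) := by
        have := h2.continuousAt.norm.tendsto
        simpa [hzero, h0] using this
      obtain ⟨ε, hε, hεb⟩ := Metric.eventually_nhds_iff_ball.1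
        (hc.eventually_lt_const (show (0 : ℝ) < 1 / 10 ^ 5 by norm_num))
      have hlim := tendsto_mul_one_div_two_pow (5 / 4)
      filter_upwards [eventually_ge_atTop 2, hlim.eventually_lt_const hε,
        hlim.eventually_lt_const one_pos] with j hj hjε hj1 w hw
      have hw2 := norm_le_of_mem_smallDisc hj hw
      have hwb : (!₂[0, w] : Cn 2) ∈ Metric.ball 0 2 := zero_pair_mem_ball (by linarith)
      have hwD : (!₂[0, w] : Cn 2) ∈ exampleDomain :=
        mem_exampleDomain_of_snd_mem_smallDisc (by omega) hwb hw
      have e : Φ !₂[0, w] = g !₂[0, w] :=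
        extension_eq_on_smallDisc hg.1 hΦ heq (show 1 ≤ j by omega) hwb hw
          (show ‖w‖ < 3 / 2 by linarith)
      have hgD := hg.2 hwD
      rw [← e] at hgD
      obtain ⟨k, hk, hmk⟩ := exists_mem_bidisc_of_norm_lt hgD
        (hεb w (mem_ball_zero_iff.2 (hw2.trans_lt hjε)))
      refine ⟨k, hk, ?_⟩
      rw [smallDisc, mem_ball_iff_norm]
      exact hmk.2
  have hfst : fderiv ℂ Φ 0 !₂[0, 1] 0 = 0 := by
    have e := norm_sq_Cn_two (fderiv ℂ Φ 0 !₂[0, 1])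
    rw [hsnd, norm_one] at e
    have : ‖fderiv ℂ Φ 0 !₂[0, 1] 0‖ ^ 2 ≤ 0 := by
      nlinarith [norm_nonneg (fderiv ℂ Φ 0 !₂[0, 1])]
    exact norm_eq_zero.1 (pow_eq_zero_iff two_ne_zero |>.1 (le_antisymm this (sq_nonneg _)))
  have hD2 : fderiv ℂ Φ 0 !₂[0, 1] = !₂[0, 1] := by
    rw [← eq_pair (fderiv ℂ Φ 0 !₂[0, 1]), hfst, hsnd]
  have hid : fderiv ℂ Φ 0 = ContinuousLinearMap.id ℂ (Cn 2) := by
    ext1 v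
    have hv : v = v 0 • (!₂[1, 0] : Cn 2) + v 1 • (!₂[0, 1] : Cn 2) := by
      ext i
      fin_cases i <;> simp
    rw [hv, map_add, map_smul, map_smul, hD1, hD2]
    rfl
  rw [hid] at hΦ0
  have hΦid : ∀ z ∈ Metric.ball (0 : Cn 2) 2, Φ z = z := fun z hz =>
    eq_id_of_fderiv_zero_eq_id two_pos hΦ hb h0 hΦ0 hz
  -- So `g` is the identity near `q₀`, and everywhere by the identity principle.
  have hqb : qLim ∈ Metric.ball (0 : Cn 2) 2 :=
    pair_zero_mem_ball (by norm_num : ‖(3 / 2 : ℂ)‖ < 2)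
  have ho : IsOpen {z : Cn 2 | 1 < ‖z 0‖} := isOpen_lt continuous_const (continuous_norm_coord 0)
  have hq1 : qLim ∈ {z : Cn 2 | 1 < ‖z 0‖} := by
    change 1 < ‖(3 / 2 : ℂ)‖
    norm_num
  have hqD : qLim ∈ exampleDomain := by
    refine shell_subset_exampleDomain (pair_mem_shell_iff.2 ?_)
    norm_num
  refine eqOn_of_differentiableOn_of_eventuallyEq isOpen_exampleDomain
    isConnected_exampleDomain.isPreconnected hg.1 differentiableOn_id hqD ?_ hz
  filter_upwards [ho.mem_nhds hq1, Metric.isOpen_ball.mem_nhds hqb] with w hw1 hwb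
  rw [← heq w hwb (Or.inl hw1), hΦid w hwb, id]

/-! ### Retractions onto the slices -/

/-- The holomorphic retraction of the ball of radius `2` onto its slice `z₂ = c`. The factor is
chosen so that `|4 - c w|² - (4 - c²) (4 - |w|²) = 4 |w - c|² ≥ 0`. -/
noncomputable def sliceRetraction (c : ℝ) (z : Cn 2) : Cn 2 :=
  !₂[(4 - (c : ℂ) ^ 2) * z 0 / (4 - c * z 1), (c : ℂ)]

theorem sq_norm_four_sub (c : ℝ) (w : ℂ) :
    ‖4 - c * w‖ ^ 2 = (4 - c ^ 2) * (4 - ‖w‖ ^ 2) + 4 * ‖w - c‖ ^ 2 := by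
  simp only [Complex.sq_norm, Complex.normSq_apply]
  simp
  ring

theorem sliceRetraction_denom_ne_zero {c : ℝ} (hc : |c| < 2) {z : Cn 2}
    (hz : z ∈ Metric.ball (0 : Cn 2) 2) : (4 - c * z 1 : ℂ) ≠ 0 := by
  rw [mem_ball_zero_two_iff] at hz
  have h := sq_norm_four_sub c (z 1)
  have hc2 : c ^ 2 < 4 := by nlinarith [sq_abs c, abs_nonneg c]
  intro h0
  rw [h0, norm_zero] at h
  nlinarith [sq_nonneg ‖z 0‖, sq_nonneg ‖z 1 - c‖]

theorem differentiableOn_sliceRetraction {c : ℝ} (hc : |c| < 2) :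
    DifferentiableOn ℂ (sliceRetraction c) (Metric.ball 0 2) := by
  rw [differentiableOn_euclidean]
  intro i
  fin_cases i
  · have h1 : Differentiable ℂ fun z : Cn 2 => (4 - (c : ℂ) ^ 2) * z 0 :=
      (differentiable_const _).mul (differentiable_coord 0)
    have h2 : Differentiable ℂ fun z : Cn 2 => 4 - (c : ℂ) * z 1 :=
      (differentiable_const _).sub ((differentiable_const _).mul (differentiable_coord 1))
    exact (h1.differentiableOn.mul (h2.differentiableOn.inv
      fun z hz => sliceRetraction_denom_ne_zero hc hz)).congr fun z _ => div_eq_mul_inv _ _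
  · exact differentiableOn_const _

theorem sliceRetraction_mem_ball {c : ℝ} (hc : |c| < 2) {z : Cn 2}
    (hz : z ∈ Metric.ball (0 : Cn 2) 2) : sliceRetraction c z ∈ Metric.ball (0 : Cn 2) 2 := by
  have h0 := norm_pos_iff.2 (sliceRetraction_denom_ne_zero hc hz)
  have hc2 : c ^ 2 < 4 := by nlinarith [sq_abs c, abs_nonneg c]
  have h := sq_norm_four_sub c (z 1)
  rw [mem_ball_zero_two_iff] at hz ⊢
  change ‖(4 - (c : ℂ) ^ 2) * z 0 / (4 - c * z 1)‖ ^ 2 + ‖(c : ℂ)‖ ^ 2 < 4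
  have e : ‖(4 - (c : ℂ) ^ 2)‖ = 4 - c ^ 2 := by
    rw [show (4 - (c : ℂ) ^ 2) = ((4 - c ^ 2 : ℝ) : ℂ) by push_cast; ring, Complex.norm_real,
      Real.norm_eq_abs, abs_of_pos (by linarith)]
  rw [norm_div, norm_mul, e, Complex.norm_real, Real.norm_eq_abs, sq_abs, div_pow,
    ← lt_sub_iff_add_lt, div_lt_iff₀ (by positivity), h, mul_pow]
  have hpos : 0 < 4 - c ^ 2 := by linarith
  nlinarith [mul_pos hpos hpos, mul_nonneg hpos.le (sq_nonneg ‖z 1 - c‖)]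

theorem sliceRetraction_eq_self {c : ℝ} (hc : |c| < 2) {z : Cn 2} (hz : z 1 = c) :
    sliceRetraction c z = z := by
  have hc2 : c ^ 2 < 4 := by nlinarith [sq_abs c, abs_nonneg c]
  have hne : (4 - (c : ℂ) ^ 2) ≠ 0 := by
    have : (4 - c ^ 2 : ℝ) ≠ 0 := by linarith
    exact_mod_cast this
  have e : (4 - (c : ℂ) ^ 2) * z 0 / (4 - c * z 1) = z 0 := by
    rw [hz, ← pow_two, mul_div_cancel_left₀ _ hne]
  rw [sliceRetraction, e, ← hz, eq_pair]

theorem isHolRetraction_sliceRetraction {j : ℕ} {U : Set (Cn 2)}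
    (hU : U ⊆ Metric.ball 0 2) (hd : disc j ⊆ U) :
    IsHolRetraction U (disc j) (sliceRetraction (1 / 2 ^ j)) := by
  have hc : |(1 / 2 ^ j : ℝ)| < 2 := by
    rw [abs_of_pos (by positivity)]
    exact (div_le_one₀ (by positivity)).2 (one_le_pow₀ one_le_two) |>.trans_lt one_lt_two
  have hcast : ((1 / 2 ^ j : ℝ) : ℂ) = 1 / 2 ^ j := by push_cast; ring
  have hmem : ∀ z ∈ U, sliceRetraction (1 / 2 ^ j) z ∈ disc j := fun z hz =>
    ⟨sliceRetraction_mem_ball hc (hU hz), hcast⟩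
  have hfix : ∀ z ∈ disc j, sliceRetraction (1 / 2 ^ j) z = z := fun z hz =>
    sliceRetraction_eq_self hc (hz.2.trans hcast.symm)
  refine ⟨⟨(differentiableOn_sliceRetraction hc).mono hU, fun z hz => hd (hmem z hz)⟩, hd, ?_,
    hfix⟩
  exact Subset.antisymm (image_subset_iff.2 hmem) fun z hz => ⟨z, hd hz, hfix z hz⟩

theorem p_mem_disc {j : ℕ} (hj : 1 ≤ j) : p j ∈ disc j := by
  refine ⟨?_, rfl⟩
  have h := norm_snd_lt_of_mem_bidisc hj (z := !₂[0, 1 / 2 ^ j]) ⟨by norm_num, by simp⟩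
  change ‖(1 / 2 ^ j : ℂ)‖ < 3 / 4 at h
  rw [mem_ball_zero_two_iff]
  change ‖(-(3 / 2) : ℂ)‖ ^ 2 + ‖(1 / 2 ^ j : ℂ)‖ ^ 2 < 4
  rw [norm_neg, show ‖(3 / 2 : ℂ)‖ = 3 / 2 by norm_num]
  nlinarith [norm_nonneg (1 / 2 ^ j : ℂ)]

theorem q_mem_disc {j : ℕ} (hj : 1 ≤ j) : q j ∈ disc j := by
  refine ⟨?_, rfl⟩
  have h := mem_ball_zero_two_iff.1 (p_mem_disc hj).1
  change ‖(-(3 / 2) : ℂ)‖ ^ 2 + ‖(1 / 2 ^ j : ℂ)‖ ^ 2 < 4 at h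
  rw [norm_neg] at h
  exact mem_ball_zero_two_iff.2 h

theorem tendsto_pair {a : ℂ} : Tendsto (fun j : ℕ => (!₂[a, 1 / 2 ^ j] : Cn 2)) atTop
    (𝓝 !₂[a, 0]) :=
  ((differentiable_pair_right a).continuous.tendsto 0).comp tendsto_one_div_two_pow

theorem qLim_mem_shell : qLim ∈ shell := by
  refine pair_mem_shell_iff.2 ?_
  norm_num

theorem pLim_mem_shell : pLim ∈ shell := by
  refine pair_mem_shell_iff.2 ?_
  norm_num

theorem pair_mem_tuples {D : Set (Cn 2)} {x y : Cn 2} (hx : x ∈ D) (hy : y ∈ D) :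
    ![x, y] ∈ tuples 2 D := by
  intro i
  fin_cases i
  · exact hx
  · exact hy

/-- The retraction onto `Δ_j` fixes `p_j` and `q_j` but moves `q₀`. -/
theorem p_q_notMem_WHat {j : ℕ} (hj : 1 ≤ j) : ![p j, q j] ∉ WHat 2 exampleDomain := by
  intro h
  have hr := isHolRetraction_sliceRetraction exampleDomain_subset_ball
    (disc_subset_exampleDomain hj)
  have hfix := h.2.2 _ hr.1 (by
    rintro _ ⟨i, rfl⟩
    fin_cases i
    · exact hr.2.2.2 _ (p_mem_disc hj)
    · exact hr.2.2.2 _ (q_mem_disc hj)) _ (shell_subset_exampleDomain qLim_mem_shell)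
  have h1 : ((1 / 2 ^ j : ℝ) : ℂ) = 0 := congrArg (fun z : Cn 2 => z 1) hfix
  simp at h1

theorem pLim_qLim_mem_WHat : ![pLim, qLim] ∈ WHat 2 exampleDomain := by
  have ht := pair_mem_tuples (shell_subset_exampleDomain pLim_mem_shell)
    (shell_subset_exampleDomain qLim_mem_shell)
  refine ⟨ht, ?_, fun g hg hk z hz => ?_⟩
  · rintro _ ⟨i, rfl⟩
    exact ht i
  · exact eq_id_of_fixes_pLim_qLim hg (hk _ ⟨0, rfl⟩) (hk _ ⟨1, rfl⟩) hz

end DeterminingSets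

open DeterminingSets in
theorem mainTheorem5 :
    DeterminingSets.IsBoundedDomain DeterminingSets.exampleDomain ∧
    DeterminingSets.exampleDomain ⊆ Metric.ball 0 2 ∧
    (∀ j : ℕ, 1 ≤ j →
      DeterminingSets.p j ∈ DeterminingSets.disc j ∧
      DeterminingSets.q j ∈ DeterminingSets.disc j ∧
      DeterminingSets.disc j ⊆ DeterminingSets.exampleDomain ∧
      (∃ r : DeterminingSets.Cn 2 → DeterminingSets.Cn 2,
        DeterminingSets.IsHolRetraction (Metric.ball 0 2) (DeterminingSets.disc j) r ∧
        DeterminingSets.IsHolRetraction DeterminingSets.exampleDomain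
          (DeterminingSets.disc j) r) ∧
      ![DeterminingSets.p j, DeterminingSets.q j] ∈
        DeterminingSets.tuples 2 DeterminingSets.exampleDomain ∧
      ![DeterminingSets.p j, DeterminingSets.q j] ∉
        DeterminingSets.WHat 2 DeterminingSets.exampleDomain) ∧
    Tendsto DeterminingSets.p atTop (𝓝 DeterminingSets.pLim) ∧
    Tendsto DeterminingSets.q atTop (𝓝 DeterminingSets.qLim) ∧
    ![DeterminingSets.pLim, DeterminingSets.qLim] ∈
      DeterminingSets.WHat 2 DeterminingSets.exampleDomain ∧
    ¬ IsOpen {x : DeterminingSets.tuples 2 DeterminingSets.exampleDomain |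
      (x : Fin 2 → DeterminingSets.Cn 2) ∈
        DeterminingSets.WHat 2 DeterminingSets.exampleDomain} := by
  have hpD : ∀ j : ℕ, 1 ≤ j → ![p j, q j] ∈ tuples 2 exampleDomain := fun j hj =>
    pair_mem_tuples (disc_subset_exampleDomain hj (p_mem_disc hj))
      (disc_subset_exampleDomain hj (q_mem_disc hj))
  have hp : Tendsto p atTop (𝓝 pLim) := tendsto_pair
  have hq : Tendsto q atTop (𝓝 qLim) := tendsto_pair
  refine ⟨isBoundedDomain_exampleDomain, exampleDomain_subset_ball, fun j hj =>
    ⟨p_mem_disc hj, q_mem_disc hj, disc_subset_exampleDomain hj,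
      ⟨_, isHolRetraction_sliceRetraction Subset.rfl fun z hz => hz.1,
        isHolRetraction_sliceRetraction exampleDomain_subset_ball
          (disc_subset_exampleDomain hj)⟩, hpD j hj, p_q_notMem_WHat hj⟩,
    hp, hq, pLim_qLim_mem_WHat, fun ho => ?_⟩
  -- Only the points with index `j ≥ 1` are known not to be determining, hence the shift.
  let x : ℕ → tuples 2 exampleDomain := fun j => ⟨![p (j + 1), q (j + 1)], hpD _ (by omega)⟩
  have hx : Tendsto x atTop (𝓝 ⟨![pLim, qLim], pLim_qLim_mem_WHat.1⟩) := by
    rw [tendsto_subtype_rng, tendsto_pi_nhds]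
    intro i
    fin_cases i
    · exact hp.comp (tendsto_add_atTop_nat 1)
    · exact hq.comp (tendsto_add_atTop_nat 1)
  obtain ⟨j, hj⟩ := (hx.eventually (ho.mem_nhds pLim_qLim_mem_WHat)).exists
  exact p_q_notMem_WHat (show 1 ≤ j + 1 by omega) hj
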